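/- **Setting.** In $\mathbb R^2$ put $v_1=(0,0)$, $v_2=(1,0)$, $v_3=(1/2,\sqrt3/2)$, $\mathbf F_i(x)=\tfrac12(x+v_i)$, $V_0=\{v_1,v_2,v_3\}$, $V_m=\bigcup_{i}\mathbf F_i(V_{m-1})$, and $\hat V_m=\bigcup_{k\ge0}2^k\,[V_{m+k}\cup(-V_{m+k})]$. The compact and the infinite Sierpinski gasket are the closures $\mathbb S=\mathrm{cl}\big(\bigcup_m V_m\big)$ and $\hat{\mathbb S}=\mathrm{cl}\big(\bigcup_m\hat V_m\big)$. The infinite gasket is a countable non-overlapping union $\hat{\mathbb S}=\bigcup_i\tau_i(\mathbb S)$, where each $\tau_i$ is a translation, or a translation followed by $x\mapsto-x$ (for the triangles in the reflected half). A *dyadic triangle* is a set $S_{i,m}=2^m\tau_i(\mathbb S)$, $m\in\mathbb Z$. Let $\nu$ be the Borel probability measure on $\mathbb S$ giving mass $3^{-m}$ to each $\mathbf F_{w_1}\cdots\mathbf F_{w_m}(\mathbb S)$, and let $\hat\nu$ be the Borel measure on $\hat{\mathbb S}$ that is a copy of $\nu$ on each $\tau_i(\mathbb S)$. For $u\in C(\hat{\mathbb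 S})$ let $$\hat{\mathcal E}(u)=\lim_{m\to\infty}\ \tfrac12\Big(\frac53\Big)^m\sum_{x\sim_m y}[u(x)-u(y)]^2\in[0,\infty],$$ where the sum is over ordered pairs of distinct points $x,y\in\hat V_m$ which are vertices of a common triangle $2^{-m}\tau_i(V_0)$ (the sequence is nondecreasing in $m$), and let $\mathcal F(\hat{\mathbb S})=\{u\in C(\hat{\mathbb S}):\hat{\mathcal E}(u)<\infty,\ u\in L^2(\hat\nu)\}$. Let $\delta_s>0$ be given by $1/\delta_s=\log 5/\log 3-1$. Throughout, $1/\infty=0$ and $t^0=1$ for all $t\in[0,\infty]$. **Theorem.** Let $1\le p\le q\le\infty$ with $q\ge2$. Let $\hat\sigma$ be a Borel measure on $\hat{\mathbb S}$ for which there are constants $C_{\hat\sigma}\ge1$ and $0<\underline\delta\le\bar\delta\le\infty$, $\bar\delta\ge1$, such that for every dyadic triangle $S$ $$\hat\sigma(S)\le C_{\hat\sigma}\,\hat\nu(S)^{1/\bar\delta}\ \text{ if } 0<\operatorname{diam}(S)<1,\qquad \hat\sigma(S)\le C_{\hat\sigma}\,\hat\nu(S)^{1/\underline\delta}\ \text{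 if } \operatorname{diam}(S)\ge1.\tag{M.1}$$ Put $$a_1=\Big[\frac{1/p-1/(q\bar\delta)}{1/p+1/(2\delta_s)}\Big]^+,\qquad a_2=\Big[\frac{1/p-1/(q\underline\delta)}{1/p+1/(2\delta_s)}\Big]^+ .$$ (1) There is a constant $C>0$, depending only on $C_{\hat\sigma}$ (not on $p,q,\underline\delta,\bar\delta$, or otherwise on $\hat\sigma$), such that $$\|u\|_{L^q(\hat\sigma)}\le C\sum_{i=1,2}\hat{\mathcal E}(u)^{a_i/2}\,\|u\|_{L^p(\hat\nu)}^{1-a_i}\qquad\text{for all }u\in\mathcal F(\hat{\mathbb S}).$$ (2) Suppose moreover that there is a sequence $\{S_m\}_{m\in\mathbb Z}$ of dyadic triangles with $\operatorname{diam}(S_m)\to0$ as $m\to-\infty$, $\operatorname{diam}(S_m)\to\infty$ as $m\to\infty$, and $$\frac1{\bar\delta}=\lim_{m\to-\infty}\frac{\log\hat\sigma(S_m)}{\log\hat\nu(S_m)},\qquad \frac1{\underline\delta}=\lim_{m\to\infty}\frac{\log\hat\sigma(S_m)}{\log\hat\nu(S_m)}.\tag{M.2}$$ Then $(a_1,a_2)$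 is optimal in the following sense: if, for some $N\ge1$, $b_1,\dots,b_N\in[0,1]$ and $C>0$, $$\|u\|_{L^q(\hat\sigma)}\le C\sum_{i=1}^N\hat{\mathcal E}(u)^{b_i/2}\,\|u\|_{L^p(\hat\nu)}^{1-b_i}\qquad\text{for all }u\in\mathcal F(\hat{\mathbb S}),$$ then $\min_i b_i\le a_2\le a_1\le\max_i b_i$. -/

import Mathlib

open MeasureTheory Set Filter Topology
open scoped NNReal ENNReal Pointwise

noncomputable section

namespace Gasket

/-- The Euclidean plane. -/
abbrev Plane : Type := EuclideanSpace ℝ (Fin 2)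

/-- The three vertices `(0,0)`, `(1,0)`, `(1/2, √3/2)` of the unit triangle. -/
def vertex : Fin 3 → Plane := ![!₂[0, 0], !₂[1, 0], !₂[1 / 2, Real.sqrt 3 / 2]]

/-- The contractions `F_i x = (x + v_i) / 2`. -/
def contraction (i : Fin 3) (x : Plane) : Plane := (2⁻¹ : ℝ) • (x + vertex i)

/-- The vertex sets `V_m` of the compact gasket. -/
def V : ℕ → Set Plane
  | 0 => range vertex
  | m + 1 => ⋃ i : Fin 3, contraction i '' V m

/-- The compact Sierpinski gasket. -/
def compactGasket : Set Plane := closure (⋃ m : ℕ, V m)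

/-- The vertex sets `⋃ₖ 2ᵏ [V_{m+k} ∪ (-V_{m+k})]` of the infinite gasket. -/
def Vhat (m : ℕ) : Set Plane := ⋃ k : ℕ, ((2 : ℝ) ^ k) • (V (m + k) ∪ -V (m + k))

/-- The infinite Sierpinski gasket. -/
def infGasket : Set Plane := closure (⋃ m : ℕ, Vhat m)

/-- Labels of the unit triangles of the infinite gasket: a sign (which of the two halves, the
union of the `2ᵏ S` or its point reflection) and a finitely supported sequence of digits. -/
abbrev CellIndex : Type := ℤˣ × (ℕ →₀ Fin 3)

/-- The offset `∑ⱼ 2ʲ v_{aⱼ}`. As `2ᵏ F_{w₁} ⋯ F_{wₖ} x = x + ∑ⱼ 2^{k-j} v_{wⱼ}`, and `v₀ = 0`,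
these are exactly the positions of the unit triangles of the union of the `2ᵏ S`. -/
def offset (a : ℕ →₀ Fin 3) : Plane := ∑ j ∈ a.support, ((2 : ℝ) ^ j) • vertex (a j)

/-- The isometries `τ_i` with `infGasket = ⋃ᵢ τ_i (compactGasket)`, the union being
non-overlapping: translations on one half, translations followed by `x ↦ -x` on the other. -/
def cellMap (i : CellIndex) (x : Plane) : Plane := i.1 • (x + offset i.2)

/-- The dyadic triangle `S_{i,m} = 2ᵐ τ_i(S)`, as a subset of the infinite gasket. -/
def dyadicTriangle (i : CellIndex) (m : ℤ) : Set infGasket :=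
  Subtype.val ⁻¹' (((2 : ℝ) ^ m) • (cellMap i '' compactGasket))

def IsDyadicTriangle (T : Set infGasket) : Prop :=
  ∃ (i : CellIndex) (m : ℤ), T = dyadicTriangle i m

/-! ### Hausdorff measures -/

/-- The point `lim_m F_{ω₀} F_{ω₁} ⋯ F_{ωₘ} (0)` of the compact gasket with address `ω`. -/
def coding (ω : ℕ → Fin 3) : Plane := ∑' n : ℕ, ((2⁻¹ : ℝ) ^ (n + 1)) • vertex (ω n)

/-- The normalised Hausdorff measure on the compact gasket, i.e. the Borel probability measure
giving mass `3⁻ᵐ` to each `F_{w₁} ⋯ F_{wₘ} (S)`: the law of the point whose address consists of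
independent uniform digits. -/
def gasketMeasure : Measure Plane :=
  (Measure.infinitePi fun _ : ℕ => (PMF.uniformOfFintype (Fin 3)).toMeasure).map coding

/-- The Hausdorff measure on the infinite gasket: a copy of `gasketMeasure` on every unit
triangle. -/
def nuHat : Measure infGasket :=
  (Measure.sum fun i : CellIndex => gasketMeasure.map (cellMap i)).comap Subtype.val

/-! ### The standard Dirichlet form -/

/-- `x` and `y` are distinct vertices of a common triangle `2⁻ᵐ τ_i(V_0)` of side `2⁻ᵐ`. -/
def Adj (m : ℕ) (x y : infGasket) : Prop :=
  x ≠ y ∧ ∃ i : CellIndex,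
    (x : Plane) ∈ ((2⁻¹ : ℝ) ^ m) • (cellMap i '' V 0) ∧
    (y : Plane) ∈ ((2⁻¹ : ℝ) ^ m) • (cellMap i '' V 0)

/-- The level `m` energy: the sum of `2⁻¹ (5/3)ᵐ (u x - u y)²` over ordered pairs of neighbours. -/
def energyApprox (m : ℕ) (u : infGasket → ℝ) : ℝ≥0∞ :=
  ∑' e : {e : infGasket × infGasket // Adj m e.1 e.2},
    ENNReal.ofReal (2⁻¹ * (5 / 3) ^ m * (u e.1.1 - u e.1.2) ^ 2)

/-- The energy, the limit of the (nondecreasing in `m`) level `m` energies. -/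
def energy (u : infGasket → ℝ) : ℝ≥0∞ := ⨆ m : ℕ, energyApprox m u

/-- The domain of the standard Dirichlet form: continuous functions for which the norm
`energy^{1/2} + ‖·‖_{L²}` is finite (this space is complete). -/
def formDomain : Set C(infGasket, ℝ) := {u | energy u < ∞ ∧ MemLp u 2 nuHat}

/-! ### Constants and conditions of the Sobolev inequality -/

/-- The spectral dimension `d_s`. -/
def spectralDim : ℝ := 2 * Real.log 3 / Real.log 5

/-- The constant `δ_s`, with `1/δ_s = 2/d_s - 1 = log 5 / log 3 - 1`. -/
def deltaS : ℝ := (2 / spectralDim - 1)⁻¹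

/-- The exponent `[(1/p - 1/(qδ)) / (1/p + 1/(2δ_s))]⁺`, with `1/∞ = 0`. -/
def sobolevExponent (p q δ : ℝ≥0∞) : ℝ :=
  max ((p⁻¹.toReal - (q * δ)⁻¹.toReal) / (p⁻¹.toReal + 1 / (2 * deltaS))) 0

/-- Dyadic upper regularity of `σ`, with exponents `δlo` (large triangles) and `δup` (small
triangles). -/
def DyadicUpperRegular (σ : Measure infGasket) (K : ℝ≥0) (δlo δup : ℝ≥0∞) : Prop :=
  ∀ T : Set infGasket, IsDyadicTriangle T →
    (0 < Metric.diam T → Metric.diam T < 1 → σ T ≤ K * nuHat T ^ δup⁻¹.toReal) ∧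
    (1 ≤ Metric.diam T → σ T ≤ K * nuHat T ^ δlo⁻¹.toReal)

/-- The exponents `δlo`, `δup` are attained along a sequence of dyadic triangles. The logarithms
take values in the extended reals, with `log 0 = -∞`. -/
def ExponentsAttained (σ : Measure infGasket) (δlo δup : ℝ≥0∞) : Prop :=
  ∃ T : ℤ → Set infGasket,
    (∀ m, IsDyadicTriangle (T m)) ∧
    Tendsto (fun m => Metric.diam (T m)) atBot (𝓝 0) ∧
    Tendsto (fun m => Metric.diam (T m)) atTop atTop ∧
    Tendsto (fun m => ENNReal.log (σ (T m)) / ENNReal.log (nuHat (T m))) atBot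
      (𝓝 ((δup⁻¹ : ℝ≥0∞) : EReal)) ∧
    Tendsto (fun m => ENNReal.log (σ (T m)) / ENNReal.log (nuHat (T m))) atTop
      (𝓝 ((δlo⁻¹ : ℝ≥0∞) : EReal))

/-- The inequality
`‖u‖_{L^q(σ)} ≤ C ∑ᵢ energy(u)^{bᵢ/2} ‖u‖_{L^p(ν)}^{1 - bᵢ}` for all `u` in the form domain. -/
def SobolevInequality (σ : Measure infGasket) (p q : ℝ≥0∞) (C : ℝ≥0) {N : ℕ} (b : Fin N → ℝ) :
    Prop :=
  ∀ u ∈ formDomain,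
    eLpNorm u q σ ≤ C * ∑ i, energy u ^ (b i / 2) * eLpNorm u p nuHat ^ (1 - b i)

end Gasket

end

/-! At every scale `n : ℤ` the gasket is tiled by cells of side `2^n` and mass `3^n`. The inequality
is first proved at one fixed scale; afterwards the scale is chosen.

Upper bound. Halving the side of the cells and multiplying the weight by 5/3 never lowers the energy
(`pairEnergy_le_sum`). Telescoping along addresses therefore bounds the oscillation of `u` on a cell
of side `2^n` by a multiple of `((5/3)^n e)^(1/2)`, where `e` is the energy inside the cell
(`abs_scaledCell_sub_le`). So on the cell `|u|` is at most this oscillation plus `3^(-n/p)` times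
the local `L^p` norm (`enorm_scaledCell_le_add`). Take `q`-th powers and sum over cells:
oscillations are square summable, local norms are `p`-summable, and `q ≥ 2`, `q ≥ p`. With `s =
1/p`, `θ = 1/(2δ_s)`, `d = 1/(qδ)` and `(5/3)^n = 3^(2nθ)`, this gives
(`eLpNorm_le_of_cell_le_rpow`) `‖u‖_q ≤ 240 K 3^(nd) (3^(nθ) E^(1/2) + 3^(-ns) ‖u‖_p)`, where `δ` is
the upper exponent for `n < 0` and the lower one for `n ≥ 0`. The scale balancing the two terms
produces the exponent `(s-d)/(s+θ)`; the sign of that scale decides which of the two exponents is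
needed (`le_of_forall_scale`).

Optimality. On each cell of side `2^n` there is a function equal to 1 there, supported in boundedly
many neighbours, with energy of order at most `(5/3)^(-n)` and `L^p` norm of order at most `3^(n/p)`
(`exists_test_function`). It is obtained by harmonic extension from the vertices, which preserves
the energy under refinement. Inserting it into an inequality with exponents `b_i` gives `σ(S)^(1/q)
≤ C' ∑ 3^(n(s - b_i(s+θ)))`. Taking logarithms, dividing by `n log 3` and letting `n → ±∞` along the
triangles that attain the exponents bounds the extreme `b_i`. -/

noncomputable section

namespace Gasket

/-! ### Geometry: coordinates, addresses and the tree of cells. -/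

/-! ### Barycentric coordinates -/

/-- The linear parts of the barycentric coordinates of the unit triangle. -/
def baryLin (k : Fin 3) : Plane →L[ℝ] ℝ :=
  let x : Plane →L[ℝ] ℝ := EuclideanSpace.proj 0
  let y : Plane →L[ℝ] ℝ := (Real.sqrt 3)⁻¹ • EuclideanSpace.proj 1
  ![-x - y, x - y, (2 : ℝ) • y] k

/-- The barycentric coordinates of the unit triangle. -/
def bary (k : Fin 3) (x : Plane) : ℝ := baryLin k x + if k = 0 then 1 else 0

lemma baryLin_vertex (k j : Fin 3) :
    baryLin k (vertex j) = (if k = j then 1 else 0) - if k = 0 then 1 else 0 := by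
  have h3 : Real.sqrt 3 ≠ 0 := by positivity
  have h4 : (Real.sqrt 3)⁻¹ * (Real.sqrt 3 / 2) = 1 / 2 := by field_simp
  fin_cases k <;> fin_cases j <;> simp [baryLin, vertex, h4]; norm_num

lemma bary_vertex (k j : Fin 3) : bary k (vertex j) = if k = j then 1 else 0 := by
  simp [bary, baryLin_vertex]

lemma baryLin_sum (x : Plane) : ∑ k, baryLin k x = 0 := by
  simp [Fin.sum_univ_three, baryLin]; ring

lemma bary_sum (x : Plane) : ∑ k, bary k x = 1 := by
  simp [bary, Finset.sum_add_distrib, baryLin_sum]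

lemma eq_of_baryLin {x y : Plane} (h : ∀ k, baryLin k x = baryLin k y) : x = y := by
  have h3 : Real.sqrt 3 ≠ 0 := by positivity
  have h1 := h 1
  have h2 := h 2
  simp [baryLin, h3] at h1 h2
  ext i
  fin_cases i
  · simp only [h2] at h1; simpa using h1
  · exact h2

lemma eq_of_bary {x y : Plane} (h : ∀ k, bary k x = bary k y) : x = y :=
  eq_of_baryLin fun k => by simpa [bary] using h k

lemma bary_contraction (k j : Fin 3) (x : Plane) :
    bary k (contraction j x) = (bary k x + if k = j then 1 else 0) / 2 := by
  simp only [bary, contraction, map_smul, map_add, baryLin_vertex, smul_eq_mul]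
  ring

lemma continuous_bary (k : Fin 3) : Continuous (bary k) := by
  unfold bary; fun_prop

lemma vertex_zero : vertex 0 = 0 := by
  ext i; fin_cases i <;> simp [vertex]

lemma eq_vertex_of_bary {x : Plane} {k : Fin 3} (h0 : ∀ j, 0 ≤ bary j x) (h : bary k x = 1) :
    x = vertex k := by
  have hs := bary_sum x
  rw [Fin.sum_univ_three] at hs
  have := h0 0
  have := h0 1
  have := h0 2
  refine eq_of_bary fun j => ?_
  rw [bary_vertex]
  fin_cases k <;> fin_cases j <;> simp at h ⊢ <;> linarith

/-! ### The contractions -/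

lemma continuous_contraction (j : Fin 3) : Continuous (contraction j) := by
  unfold contraction; fun_prop

lemma contraction_injective (j : Fin 3) : Function.Injective (contraction j) := by
  intro x y h
  simpa [contraction] using h

lemma contraction_vertex_self (j : Fin 3) : contraction j (vertex j) = vertex j := by
  rw [contraction, ← two_smul ℝ, smul_smul]; norm_num

lemma contraction_vertex_comm (j k : Fin 3) :
    contraction j (vertex k) = contraction k (vertex j) := by
  simp [contraction, add_comm]

/-! ### Addresses -/

/-- The address `j ω₀ ω₁ ⋯`. -/
def consAddr (j : Fin 3) (ω : ℕ → Fin 3) : ℕ → Fin 3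
  | 0 => j
  | n + 1 => ω n

/-- The address `ω₁ ω₂ ⋯`. -/
def tailAddr (ω : ℕ → Fin 3) : ℕ → Fin 3 := fun n => ω (n + 1)

lemma consAddr_tailAddr (ω : ℕ → Fin 3) : consAddr (ω 0) (tailAddr ω) = ω := by
  ext n; cases n <;> rfl

lemma exists_norm_vertex_le : ∃ B : ℝ, ∀ j, ‖vertex j‖ ≤ B :=
  ⟨∑ j, ‖vertex j‖, fun j => Finset.single_le_sum (f := fun j => ‖vertex j‖)
    (fun _ _ => norm_nonneg _) (Finset.mem_univ j)⟩

lemma exists_summable_coding_bound : ∃ b : ℕ → ℝ, Summable b ∧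
    ∀ n (j : Fin 3), ‖((2⁻¹ : ℝ) ^ (n + 1)) • vertex j‖ ≤ b n := by
  obtain ⟨B, hB⟩ := exists_norm_vertex_le
  refine ⟨fun n => (2⁻¹ : ℝ) ^ (n + 1) * B, ?_, fun n j => ?_⟩
  · exact ((summable_nat_add_iff 1).2
      (summable_geometric_of_lt_one (by norm_num) (by norm_num))).mul_right B
  · rw [norm_smul, Real.norm_of_nonneg (by positivity)]
    exact mul_le_mul_of_nonneg_left (hB j) (by positivity)

lemma summable_coding (ω : ℕ → Fin 3) :
    Summable fun n : ℕ => ((2⁻¹ : ℝ) ^ (n + 1)) • vertex (ω n) := by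
  obtain ⟨b, hb, h⟩ := exists_summable_coding_bound
  exact Summable.of_norm_bounded hb fun n => h n _

lemma continuous_coding : Continuous coding := by
  obtain ⟨b, hb, h⟩ := exists_summable_coding_bound
  refine continuous_tsum (fun n => ?_) hb fun n ω => h n _
  have h' : Continuous fun ω : ℕ → Fin 3 => vertex (ω n) :=
    (continuous_of_discreteTopology (f := vertex)).comp (continuous_apply n)
  exact h'.const_smul ((2⁻¹ : ℝ) ^ (n + 1))

lemma coding_cons (j : Fin 3) (ω : ℕ → Fin 3) :
    coding (consAddr j ω) = contraction j (coding ω) := by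
  rw [coding, (summable_coding _).tsum_eq_zero_add, contraction, smul_add, add_comm, coding,
    ← (summable_coding ω).tsum_const_smul (2⁻¹ : ℝ)]
  congr 1
  · refine tsum_congr fun n => ?_
    rw [smul_smul, consAddr, pow_succ' _ (n + 1)]
  · simp [consAddr]

lemma coding_eq (ω : ℕ → Fin 3) : coding ω = contraction (ω 0) (coding (tailAddr ω)) := by
  rw [← coding_cons, consAddr_tailAddr]

lemma coding_const (j : Fin 3) : coding (fun _ => j) = vertex j := by
  apply contraction_injective j |>.eq_iff.1
  have h := coding_eq fun _ => j
  have h2 : tailAddr (fun _ => j) = fun _ => j := rfl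
  rw [h2] at h
  rw [← h, contraction_vertex_self]
  rw [contraction] at h
  generalize coding (fun _ => j) = x at h ⊢
  have : (2 : ℝ) • x = x + vertex j := by
    conv_lhs => rw [h]
    rw [smul_smul]; norm_num
  rw [two_smul] at this
  exact add_left_cancel this

/-- The iterated contraction `F_{ω₀} ⋯ F_{ω_{m-1}}`. -/
def iterContraction : ℕ → (ℕ → Fin 3) → Plane → Plane
  | 0, _, x => x
  | m + 1, ω, x => contraction (ω 0) (iterContraction m (tailAddr ω) x)

lemma iterContraction_vertex_mem (m : ℕ) (ω : ℕ → Fin 3) (j : Fin 3) :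
    iterContraction m ω (vertex j) ∈ V m := by
  induction m generalizing ω with
  | zero => exact mem_range_self j
  | succ m ih => exact mem_iUnion.2 ⟨ω 0, mem_image_of_mem _ (ih _)⟩

lemma iterContraction_eq (m : ℕ) (ω : ℕ → Fin 3) (x : Plane) : iterContraction m ω x =
    ((2⁻¹ : ℝ) ^ m) • x + ∑ n ∈ Finset.range m, ((2⁻¹ : ℝ) ^ (n + 1)) • vertex (ω n) := by
  induction m generalizing ω with
  | zero => simp [iterContraction]
  | succ m ih =>
    rw [iterContraction, ih, contraction, Finset.sum_range_succ', smul_add, smul_add, smul_smul,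
      Finset.smul_sum, add_assoc, pow_succ' _ m]
    congr 2
    · refine Finset.sum_congr rfl fun n _ => ?_
      rw [smul_smul, tailAddr, pow_succ' _ (n + 1)]
    · simp

lemma tendsto_iterContraction (ω : ℕ → Fin 3) (x : Plane) :
    Tendsto (fun m => iterContraction m ω x) atTop (𝓝 (coding ω)) := by
  simp_rw [iterContraction_eq]
  have h1 : Tendsto (fun m : ℕ => ((2⁻¹ : ℝ) ^ m) • x) atTop (𝓝 ((0 : ℝ) • x)) :=
    (tendsto_pow_atTop_nhds_zero_of_lt_one (by norm_num) (by norm_num)).smul_const x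
  simpa [coding] using h1.add (summable_coding ω).hasSum.tendsto_sum_nat

lemma V_subset_range_coding (m : ℕ) : V m ⊆ range coding := by
  induction m with
  | zero => rintro _ ⟨j, rfl⟩; exact ⟨_, coding_const j⟩
  | succ m ih =>
    intro x hx
    obtain ⟨i, y, hy, rfl⟩ := mem_iUnion.1 hx
    obtain ⟨ω, rfl⟩ := ih hy
    exact ⟨_, coding_cons i ω⟩

/-- The image of the compact address space is closed and contains every `V m`; conversely each coded
point is the limit of the vertices `iterContraction m ω (vertex 0)`. -/
lemma compactGasket_eq_range : compactGasket = range coding := by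
  refine Subset.antisymm ?_ ?_
  · exact closure_minimal (iUnion_subset V_subset_range_coding)
      (isCompact_range continuous_coding).isClosed
  · rintro _ ⟨ω, rfl⟩
    refine mem_closure_of_tendsto (tendsto_iterContraction ω (vertex 0))
      (Eventually.of_forall fun m => ?_)
    exact mem_iUnion.2 ⟨m, iterContraction_vertex_mem m ω 0⟩

lemma coding_mem (ω : ℕ → Fin 3) : coding ω ∈ compactGasket := by
  rw [compactGasket_eq_range]; exact mem_range_self _

lemma vertex_mem (j : Fin 3) : vertex j ∈ compactGasket := coding_const j ▸ coding_mem _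

lemma isCompact_compactGasket : IsCompact compactGasket := by
  rw [compactGasket_eq_range]; exact isCompact_range continuous_coding

lemma contraction_mem {j : Fin 3} {x : Plane} (hx : x ∈ compactGasket) :
    contraction j x ∈ compactGasket := by
  rw [compactGasket_eq_range] at hx
  obtain ⟨ω, rfl⟩ := hx
  rw [← coding_cons]; exact coding_mem _

lemma exists_contraction {x : Plane} (hx : x ∈ compactGasket) :
    ∃ j, ∃ y ∈ compactGasket, x = contraction j y := by
  rw [compactGasket_eq_range] at hx
  obtain ⟨ω, rfl⟩ := hx
  exact ⟨ω 0, _, coding_mem (tailAddr ω), coding_eq ω⟩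

lemma bary_nonneg {x : Plane} (hx : x ∈ compactGasket) (k : Fin 3) : 0 ≤ bary k x := by
  have hV : ∀ m, V m ⊆ {x | 0 ≤ bary k x} := by
    intro m
    induction m with
    | zero =>
      rintro _ ⟨j, rfl⟩
      rw [mem_ofPred_eq, bary_vertex]
      split_ifs <;> norm_num
    | succ m ih =>
      intro x hx
      obtain ⟨i, y, hy, rfl⟩ := mem_iUnion.1 hx
      have := ih hy
      rw [mem_ofPred_eq] at this ⊢
      rw [bary_contraction]
      split_ifs <;> linarith
  exact closure_minimal (iUnion_subset hV) (isClosed_le continuous_const (continuous_bary k)) hx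

lemma bary_le_one {x : Plane} (hx : x ∈ compactGasket) (k : Fin 3) : bary k x ≤ 1 := by
  rw [← bary_sum x]
  exact Finset.single_le_sum (f := fun k => bary k x) (fun j _ => bary_nonneg hx j)
    (Finset.mem_univ k)

/-! ### Indices of cells -/

/-- The digit sequence `j a₀ a₁ ⋯`. -/
def consDigit (j : Fin 3) (a : ℕ →₀ Fin 3) : ℕ →₀ Fin 3 :=
  Finsupp.ofSupportFinite (consAddr j a) <| by
    refine ((a.hasFiniteSupport.image (· + 1)).union (finite_singleton 0)).subset fun n hn => ?_
    cases n with
    | zero => simp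
    | succ n => exact Or.inl ⟨n, hn, rfl⟩

/-- The digit sequence `a₁ a₂ ⋯`. -/
def tailDigit (a : ℕ →₀ Fin 3) : ℕ →₀ Fin 3 :=
  Finsupp.comapDomain (· + 1) a (add_left_injective 1).injOn

@[simp] lemma consDigit_zero (j : Fin 3) (a : ℕ →₀ Fin 3) : consDigit j a 0 = j := rfl

@[simp] lemma consDigit_succ (j : Fin 3) (a : ℕ →₀ Fin 3) (n : ℕ) :
    consDigit j a (n + 1) = a n := rfl

@[simp] lemma tailDigit_apply (a : ℕ →₀ Fin 3) (n : ℕ) : tailDigit a n = a (n + 1) := rfl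

lemma consDigit_tailDigit (a : ℕ →₀ Fin 3) : consDigit (a 0) (tailDigit a) = a := by
  ext n; cases n <;> simp

lemma tailDigit_consDigit (j : Fin 3) (a : ℕ →₀ Fin 3) : tailDigit (consDigit j a) = a := by
  ext n; simp

lemma offset_eq_sum_range {a : ℕ →₀ Fin 3} {N : ℕ} (h : ∀ n, N ≤ n → a n = 0) :
    offset a = ∑ j ∈ Finset.range N, ((2 : ℝ) ^ j) • vertex (a j) := by
  refine Finset.sum_subset (fun n hn => ?_) fun n _ hn => ?_
  · by_contra h'
    exact Finsupp.mem_support_iff.1 hn (h n (by simpa using h'))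
  · rw [Finsupp.notMem_support_iff.1 hn, vertex_zero, smul_zero]

lemma exists_forall_digit_eq_zero (a : ℕ →₀ Fin 3) : ∃ N, ∀ n, N ≤ n → a n = 0 := by
  refine ⟨a.support.sup id + 1, fun n hn => ?_⟩
  by_contra h
  have : n ≤ a.support.sup id := Finset.le_sup (f := id) (Finsupp.mem_support_iff.2 h)
  omega

lemma offset_consDigit (j : Fin 3) (a : ℕ →₀ Fin 3) :
    offset (consDigit j a) = vertex j + (2 : ℝ) • offset a := by
  obtain ⟨N, hN⟩ := exists_forall_digit_eq_zero a
  rw [offset_eq_sum_range hN, offset_eq_sum_range (N := N + 1), Finset.sum_range_succ', add_comm,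
    Finset.smul_sum]
  · congr 1
    · simp
    · refine Finset.sum_congr rfl fun n _ => ?_
      rw [smul_smul, consDigit_succ, pow_succ']
  · intro n hn
    cases n with
    | zero => omega
    | succ n => exact hN n (by omega)

lemma offset_zero : offset 0 = 0 := by simp [offset]

/-- Integrality is the source of the injectivity of `offset`, of the separation of cells and of
local finiteness. -/
lemma exists_baryLin_offset (a : ℕ →₀ Fin 3) (k : Fin 3) : ∃ z : ℤ, baryLin k (offset a) = z := by
  rw [offset]
  induction a.support using Finset.induction_on with
  | empty => exact ⟨0, by simp⟩
  | insert j s hj ih =>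
  obtain ⟨z, hz⟩ := ih
  refine ⟨2 ^ j * ((if k = a j then 1 else 0) - if k = 0 then 1 else 0) + z, ?_⟩
  rw [Finset.sum_insert hj, map_add, hz, map_smul, baryLin_vertex]
  push_cast
  simp

lemma baryLin_offset_nonneg (a : ℕ →₀ Fin 3) {k : Fin 3} (hk : k ≠ 0) :
    0 ≤ baryLin k (offset a) := by
  rw [offset, map_sum]
  refine Finset.sum_nonneg fun j _ => ?_
  rw [map_smul, baryLin_vertex, if_neg hk, smul_eq_mul]
  split_ifs <;> simp

/-- A parity argument: an offset is `vertex (a 0)` plus twice an integral vector, and the three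
vertices differ modulo 2. -/
lemma digit_zero_eq_of_offset_eq {a b : ℕ →₀ Fin 3} (h : offset a = offset b) : a 0 = b 0 := by
  rw [← consDigit_tailDigit a, ← consDigit_tailDigit b, offset_consDigit, offset_consDigit] at h
  by_contra hne
  obtain ⟨y, hy⟩ := exists_baryLin_offset (tailDigit a) (a 0)
  obtain ⟨z, hz⟩ := exists_baryLin_offset (tailDigit b) (a 0)
  have h' := congrArg (baryLin (a 0)) h
  rw [map_add, map_add, map_smul, map_smul, baryLin_vertex, baryLin_vertex, hy, hz, if_pos rfl,
    if_neg hne] at h'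
  simp only [smul_eq_mul] at h'
  have h2 : (1 : ℝ) = ((2 * (z - y) : ℤ) : ℝ) := by push_cast; linarith
  have h3 : (1 : ℤ) = 2 * (z - y) := by exact_mod_cast h2
  omega

lemma offset_injective : Function.Injective offset := by
  have key : ∀ (n : ℕ) (a b : ℕ →₀ Fin 3), offset a = offset b → a n = b n := by
    intro n
    induction n with
    | zero => exact fun a b h => digit_zero_eq_of_offset_eq h
    | succ n ih =>
      intro a b h
      have h0 := digit_zero_eq_of_offset_eq h
      refine ih (tailDigit a) (tailDigit b) ?_
      rw [← consDigit_tailDigit a, ← consDigit_tailDigit b, offset_consDigit,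
        offset_consDigit, h0] at h
      simpa using h
  exact fun a b h => Finsupp.ext fun n => key n a b h

/-! ### Cells of every scale -/

/-- The similarity mapping the compact gasket onto the cell `i` of side `2ⁿ`. -/
def scaledCell (i : CellIndex) (n : ℤ) (x : Plane) : Plane := (2 : ℝ) ^ n • cellMap i x

/-- The cell `i` of side `2ⁿ`. -/
def cell (i : CellIndex) (n : ℤ) : Set Plane := scaledCell i n '' compactGasket

/-- The index of the `j`-th cell of half the side in a cell. -/
def child (i : CellIndex) (j : Fin 3) : CellIndex := (i.1, consDigit j i.2)

/-- A cell index consists of the index of a cell of double side and a digit. -/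
def childEquiv : CellIndex × Fin 3 ≃ CellIndex where
  toFun p := child p.1 p.2
  invFun i := ((i.1, tailDigit i.2), i.2 0)
  left_inv p := by simp [child, tailDigit_consDigit]
  right_inv i := by simp [child, consDigit_tailDigit]

/-- The same index type labels the cells of every scale, so passing to half the side is just a
reindexing by `childEquiv`. -/
lemma tsum_child (f : CellIndex → ℝ≥0∞) : ∑' i, ∑ j, f (child i j) = ∑' i, f i := by
  rw [← childEquiv.tsum_eq f]
  refine Eq.trans ?_ (ENNReal.tsum_prod (f := fun i j => f (child i j))).symm
  exact tsum_congr fun i => (tsum_fintype fun j => f (child i j)).symm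

lemma cellMap_eq (i : CellIndex) (x : Plane) :
    cellMap i x = ((i.1 : ℤ) : ℝ) • (x + offset i.2) := by
  rw [cellMap, Units.smul_def, Int.cast_smul_eq_zsmul]

lemma sign_ne_zero (s : ℤˣ) : ((s : ℤ) : ℝ) ≠ 0 := by exact_mod_cast s.ne_zero

lemma abs_sign (s : ℤˣ) : |((s : ℤ) : ℝ)| = 1 := by
  rcases Int.units_eq_one_or s with rfl | rfl <;> simp

lemma scaledCell_eq (i : CellIndex) (n : ℤ) (x : Plane) :
    scaledCell i n x = ((2 : ℝ) ^ n * ((i.1 : ℤ) : ℝ)) • (x + offset i.2) := by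
  rw [scaledCell, cellMap_eq, smul_smul]

lemma scaledCell_contraction (i : CellIndex) (n : ℤ) (j : Fin 3) (x : Plane) :
    scaledCell i n (contraction j x) = scaledCell (child i j) (n - 1) x := by
  rw [scaledCell_eq, scaledCell_eq, child, offset_consDigit, contraction,
    zpow_sub_one₀ (two_ne_zero), mul_right_comm, mul_smul _ (2⁻¹ : ℝ)]
  congr 1
  simp only [smul_add, smul_smul]
  norm_num [add_assoc]

lemma continuous_scaledCell (i : CellIndex) (n : ℤ) : Continuous (scaledCell i n) := by
  simp only [funext (scaledCell_eq i n)]; fun_prop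

lemma scale_ne_zero (i : CellIndex) (n : ℤ) : (2 : ℝ) ^ n * ((i.1 : ℤ) : ℝ) ≠ 0 :=
  mul_ne_zero (zpow_ne_zero _ two_ne_zero) (sign_ne_zero _)

lemma scaledCell_injective (i : CellIndex) (n : ℤ) : Function.Injective (scaledCell i n) := by
  intro x y h
  rw [scaledCell_eq, scaledCell_eq] at h
  exact add_right_cancel (smul_right_injective _ (scale_ne_zero i n) h)

lemma dist_scaledCell (i : CellIndex) (n : ℤ) (x y : Plane) :
    dist (scaledCell i n x) (scaledCell i n y) = 2 ^ n * dist x y := by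
  rw [scaledCell_eq, scaledCell_eq, dist_smul₀, norm_mul, Real.norm_eq_abs _, Real.norm_eq_abs _,
    abs_sign, abs_of_nonneg (by positivity), mul_one, dist_add_right]

lemma isCompact_cell (i : CellIndex) (n : ℤ) : IsCompact (cell i n) :=
  isCompact_compactGasket.image (continuous_scaledCell i n)

lemma measurableSet_cell (i : CellIndex) (n : ℤ) : MeasurableSet (cell i n) :=
  (isCompact_cell i n).isClosed.measurableSet

lemma cell_eq_iUnion_child (i : CellIndex) (n : ℤ) : cell i n = ⋃ j, cell (child i j) (n - 1) := by
  ext p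
  simp only [cell, mem_iUnion, mem_image]
  constructor
  · rintro ⟨x, hx, rfl⟩
    obtain ⟨j, y, hy, rfl⟩ := exists_contraction hx
    exact ⟨j, y, hy, (scaledCell_contraction i n j y).symm⟩
  · rintro ⟨j, y, hy, rfl⟩
    exact ⟨contraction j y, contraction_mem hy, scaledCell_contraction i n j y⟩

lemma iUnion_cell_sub_one (n : ℤ) : ⋃ i, cell i (n - 1) = ⋃ i, cell i n := by
  ext p
  simp only [cell_eq_iUnion_child _ n, mem_iUnion]
  constructor
  · rintro ⟨i, hi⟩
    refine ⟨(childEquiv.symm i).1, (childEquiv.symm i).2, ?_⟩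
    have : child (childEquiv.symm i).1 (childEquiv.symm i).2 = i := childEquiv.apply_symm_apply i
    rwa [this]
  · rintro ⟨i, j, hi⟩
    exact ⟨_, hi⟩

lemma iUnion_cell_eq (n : ℤ) : ⋃ i, cell i n = ⋃ i, cell i 0 := by
  induction n using Int.induction_on with
  | zero => rfl
  | succ n ih => rw [← ih, ← iUnion_cell_sub_one]; simp
  | pred n ih => rw [iUnion_cell_sub_one, ih]

/-! ### Vertices -/

lemma V_mono : Monotone V := by
  refine monotone_nat_of_le_succ fun m => ?_
  induction m with
  | zero =>
    rintro _ ⟨j, rfl⟩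
    exact mem_iUnion.2 ⟨j, vertex j, mem_range_self j, contraction_vertex_self j⟩
  | succ m ih =>
    exact iUnion_mono fun i => image_mono ih

/-- Every cell is a descendant of one of the two cells at the origin. -/
lemma exists_scaledCell_mem (i : CellIndex) : ∃ K : ℕ, ∀ k, K ≤ k → ∀ (n : ℤ) (l : ℕ),
    ∀ y ∈ V l, scaledCell i n y ∈ scaledCell (i.1, 0) (n + k) '' V (l + k) := by
  obtain ⟨K, hK⟩ := exists_forall_digit_eq_zero i.2
  refine ⟨K, fun k hk => ?_⟩
  obtain ⟨s, a⟩ := i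
  replace hK : ∀ n, k ≤ n → a n = 0 := fun n hn => hK n (hk.trans hn)
  clear hk
  induction k generalizing a with
  | zero =>
    intro n l y hy
    have : a = 0 := Finsupp.ext fun n => hK n (by omega)
    exact ⟨y, hy, by simp [this]⟩
  | succ k ih =>
    intro n l y hy
    have h := ih (tailDigit a) (fun n hn => hK (n + 1) (by omega)) (n + 1) (l + 1)
      (contraction (a 0) y) (mem_iUnion.2 ⟨a 0, mem_image_of_mem _ hy⟩)
    rw [scaledCell_contraction, child] at h
    simp only [consDigit_tailDigit, add_sub_cancel_right] at h
    convert h using 2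
    · rw [Nat.cast_succ, add_assoc, add_comm (1 : ℤ)]
    · congr 1; omega

lemma mem_Vhat_iff {m : ℕ} {p : Plane} : p ∈ Vhat m ↔
    ∃ (k : ℕ) (s : ℤˣ), p ∈ scaledCell (s, 0) k '' V (m + k) := by
  simp only [Vhat, mem_iUnion]
  refine exists_congr fun k => ?_
  constructor
  · rintro ⟨q, hq | hq, rfl⟩
    · exact ⟨1, q, hq, by simp [scaledCell_eq, offset_zero]⟩
    · exact ⟨-1, -q, hq, by simp [scaledCell_eq, offset_zero]⟩
  · rintro ⟨s, y, hy, rfl⟩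
    rcases Int.units_eq_one_or s with rfl | rfl
    · exact ⟨y, Or.inl hy, by simp [scaledCell_eq, offset_zero]⟩
    · exact ⟨-y, Or.inr (by simpa using hy), by simp [scaledCell_eq, offset_zero]⟩

lemma cell_subset_infGasket (i : CellIndex) (n : ℤ) : cell i n ⊆ infGasket := by
  have h : scaledCell i n '' (⋃ m, V m) ⊆ ⋃ m, Vhat m := by
    rintro _ ⟨y, hy, rfl⟩
    obtain ⟨l, hl⟩ := mem_iUnion.1 hy
    obtain ⟨K, hK⟩ := exists_scaledCell_mem i
    -- Raising the level by `n.toNat` keeps the final level `l + n.toNat - n` nonnegative; the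
    -- ancestor is taken high enough that its scale `k'` is a natural number.
    have hl' : y ∈ V (l + n.toNat) := V_mono (by omega) hl
    obtain ⟨k', hk'⟩ : ∃ k' : ℕ, n + (K + n.natAbs : ℕ) = (k' : ℤ) := ⟨(n + (K + n.natAbs : ℕ)).toNat,
      by omega⟩
    have := hK (K + n.natAbs) (by omega) n _ y hl'
    rw [hk'] at this
    refine mem_iUnion.2 ⟨((l + n.toNat : ℕ) - n).toNat, mem_Vhat_iff.2 ⟨k', i.1, ?_⟩⟩
    convert this using 2
    congr 1; omega
  exact (image_closure_subset_closure_image (continuous_scaledCell i n)).trans (closure_mono h)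

/-! ### Intersections of cells -/

lemma baryLin_scaledCell (i : CellIndex) (n : ℤ) (x : Plane) (k : Fin 3) :
    baryLin k (scaledCell i n x) =
      2 ^ n * ((i.1 : ℤ) : ℝ) * (baryLin k x + baryLin k (offset i.2)) := by
  rw [scaledCell_eq, map_smul, map_add, smul_eq_mul]

/-- Two distinct cells of the same scale meet in common vertices only. -/
lemma exists_vertex_of_scaledCell_eq {i i' : CellIndex} {n : ℤ} {x y : Plane}
    (hx : x ∈ compactGasket) (hy : y ∈ compactGasket) (hne : i ≠ i')
    (h : scaledCell i n x = scaledCell i' n y) : ∃ a, x = vertex a := by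
  obtain ⟨s, o⟩ := i
  obtain ⟨s', o'⟩ := i'
  have hb : ∀ k, ((s : ℤ) : ℝ) * (baryLin k x + baryLin k (offset o)) =
      ((s' : ℤ) : ℝ) * (baryLin k y + baryLin k (offset o')) := by
    intro k
    have := congrArg (baryLin k) h
    rw [baryLin_scaledCell, baryLin_scaledCell, mul_assoc, mul_assoc] at this
    exact mul_left_cancel₀ (zpow_ne_zero _ two_ne_zero) this
  by_cases hs : s = s'
  -- Same half: the coordinates of `x` and `y` differ by integers with sum zero that are not all
  -- zero. Some difference is at least 1, which forces that coordinate of `x`, lying in `[0,1]`, to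
  -- be 1.
  · subst hs
    have ho : o ≠ o' := fun h => hne (by rw [h])
    have hb' : ∀ k, bary k x - bary k y = baryLin k (offset o') - baryLin k (offset o) := by
      intro k
      have := mul_left_cancel₀ (sign_ne_zero s) (hb k)
      simp only [bary]; linarith
    choose z hz using exists_baryLin_offset o
    choose z' hz' using exists_baryLin_offset o'
    have hd : ∀ k, bary k x - bary k y = ((z' k - z k : ℤ) : ℝ) := by
      intro k; rw [hb', hz, hz']; push_cast; ring
    have hex : ∃ k, 1 ≤ z' k - z k := by
      by_contra hcon
      push Not at hcon
      have hsum : ∑ k, (z' k - z k) = 0 := by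
        have : ((∑ k, (z' k - z k) : ℤ) : ℝ) = 0 := by
          rw [Int.cast_sum, ← Finset.sum_congr rfl fun k _ => hd k, Finset.sum_sub_distrib,
            bary_sum, bary_sum, sub_self]
        exact_mod_cast this
      rw [Fin.sum_univ_three] at hsum
      have h0 := hcon 0
      have h1 := hcon 1
      have h2 := hcon 2
      refine ho (offset_injective (eq_of_baryLin fun k => ?_))
      rw [hz, hz']
      have : z k = z' k := by fin_cases k <;> simp <;> omega
      rw [this]
    obtain ⟨k, hk⟩ := hex
    have hk' : (1 : ℝ) ≤ ((z' k - z k : ℤ) : ℝ) := by exact_mod_cast hk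
    rw [← hd k] at hk'
    have h1 := bary_le_one hx k
    have h2 := bary_nonneg hy k
    exact ⟨k, eq_vertex_of_bary (bary_nonneg hx) (by linarith)⟩
  -- Opposite halves: coordinates 1 and 2 are nonnegative on one half and nonpositive on the other,
  -- so they vanish and only the origin is shared.
  · have hs' : ((s' : ℤ) : ℝ) = -((s : ℤ) : ℝ) := by
      rcases Int.units_eq_one_or s with rfl | rfl <;>
        rcases Int.units_eq_one_or s' with rfl | rfl <;> simp at hs ⊢
    have h0 : ∀ k, k ≠ 0 → bary k x = 0 := by
      intro k hk
      have h1 := hb k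
      rw [hs', neg_mul, ← mul_neg] at h1
      have h2 := mul_left_cancel₀ (sign_ne_zero s) h1
      have h3 := bary_nonneg hx k
      have h4 := bary_nonneg hy k
      have h5 := baryLin_offset_nonneg o hk
      have h6 := baryLin_offset_nonneg o' hk
      simp only [bary, if_neg hk, add_zero] at h3 h4 ⊢
      linarith
    refine ⟨0, eq_vertex_of_bary (bary_nonneg hx) ?_⟩
    have := bary_sum x
    rw [Fin.sum_univ_three, h0 1 (by decide), h0 2 (by decide)] at this
    linarith

/-- The index of a cell is determined by its sign and one of its vertices. -/
lemma eq_of_scaledCell_vertex_eq {i i' : CellIndex} {n : ℤ} {x : Plane} (hs : i.1 = i'.1)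
    (h : scaledCell i n x = scaledCell i' n x) : i = i' := by
  obtain ⟨s, o⟩ := i
  obtain ⟨s', o'⟩ := i'
  simp only at hs
  subst hs
  rw [scaledCell_eq, scaledCell_eq] at h
  have := add_left_cancel (smul_right_injective _ (scale_ne_zero (s, o) n) h)
  exact congrArg (Prod.mk s) (offset_injective this)

/-! ### Local finiteness -/

/-- Bounded integer vectors are finite in number and determine the digits. -/
lemma finite_setOf_baryLin_offset_le (B : ℝ) :
    {a : ℕ →₀ Fin 3 | ∀ k, |baryLin k (offset a)| ≤ B}.Finite := by
  choose z hz using exists_baryLin_offset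
  have hinj : Function.Injective z := fun a b h => offset_injective <| eq_of_baryLin fun k => by
    rw [hz, hz, h]
  refine Finite.of_finite_image (f := z) ?_ hinj.injOn
  refine (Set.Finite.pi' (fun _ : Fin 3 => finite_Icc (-⌈B⌉) ⌈B⌉)).subset ?_
  rintro _ ⟨a, ha, rfl⟩ k
  have := abs_le.1 (ha k)
  rw [hz] at this
  constructor
  · have h1 : ((-⌈B⌉ : ℤ) : ℝ) ≤ z a k := by push_cast; linarith [Int.le_ceil B, this.1]
    exact_mod_cast h1
  · have h1 : (z a k : ℝ) ≤ (⌈B⌉ : ℤ) := this.2.trans (Int.le_ceil B)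
    exact_mod_cast h1

lemma locallyFinite_cell (n : ℤ) : LocallyFinite fun i => cell i n := by
  intro p
  refine ⟨Metric.ball p 1, Metric.ball_mem_nhds p one_pos, ?_⟩
  obtain ⟨R, hR⟩ : ∃ R, ∀ q ∈ Metric.ball p 1, ∀ k, |baryLin k q| ≤ R := by
    have : ∀ k, ∃ R, ∀ q ∈ Metric.ball p 1, |baryLin k q| ≤ R := by
      intro k
      obtain ⟨R, hR⟩ := (isCompact_closedBall p 1).exists_bound_of_continuousOn
        (baryLin k).continuous.continuousOn
      exact ⟨R, fun q hq => hR q (Metric.ball_subset_closedBall hq)⟩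
    choose R hR using this
    refine ⟨∑ k, |R k|, fun q hq k => ((hR k q hq).trans (le_abs_self _)).trans ?_⟩
    exact Finset.single_le_sum (f := fun k => |R k|) (fun _ _ => abs_nonneg _) (Finset.mem_univ k)
  have hfin := finite_setOf_baryLin_offset_le (R / 2 ^ n + 1)
  refine ((finite_univ (α := ℤˣ)).prod hfin).subset ?_
  rintro ⟨s, o⟩ ⟨q, ⟨x, hx, rfl⟩, hq⟩
  refine ⟨mem_univ _, fun k => ?_⟩
  have h1 := hR _ hq k
  have h2 : (0 : ℝ) < 2 ^ n := by positivity
  rw [baryLin_scaledCell, abs_mul, abs_mul, abs_sign, abs_of_pos h2, mul_one,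
    ← le_div_iff₀' h2] at h1
  have h3 : |baryLin k x| ≤ 1 := by
    have h4 := bary_nonneg hx k
    have h5 := bary_le_one hx k
    simp only [bary] at h4 h5
    rw [abs_le]
    split_ifs at h4 h5 <;> constructor <;> linarith
  calc |baryLin k (offset o)| = |(baryLin k x + baryLin k (offset o)) - baryLin k x| := by
        congr 1; ring
    _ ≤ _ := abs_sub _ _
    _ ≤ _ := by simp only at h1; linarith

lemma infGasket_eq_iUnion_cell (n : ℤ) : infGasket = ⋃ i, cell i n := by
  refine Subset.antisymm ?_ (iUnion_subset fun i => cell_subset_infGasket i n)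
  refine closure_minimal (iUnion_subset fun m p hp => ?_)
    ((locallyFinite_cell n).isClosed_iUnion fun i => (isCompact_cell i n).isClosed)
  obtain ⟨k, s, y, hy, rfl⟩ := mem_Vhat_iff.1 hp
  rw [iUnion_cell_eq, ← iUnion_cell_eq k]
  refine mem_iUnion.2 ⟨(s, 0), mem_image_of_mem _ ?_⟩
  exact subset_closure (mem_iUnion.2 ⟨_, hy⟩)

lemma exists_eq_scaledCell (n : ℤ) (p : infGasket) :
    ∃ i, ∃ x ∈ compactGasket, scaledCell i n x = p := by
  exact mem_iUnion.1 ((infGasket_eq_iUnion_cell n).subset p.2)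

lemma isClosed_infGasket : IsClosed infGasket := isClosed_closure

lemma scaledCell_mem {i : CellIndex} {n : ℤ} {x : Plane} (hx : x ∈ compactGasket) :
    scaledCell i n x ∈ infGasket := cell_subset_infGasket i n (mem_image_of_mem _ hx)

/-! ### Dyadic triangles -/

lemma dyadicTriangle_eq (i : CellIndex) (n : ℤ) :
    dyadicTriangle i n = Subtype.val ⁻¹' cell i n := by
  rw [dyadicTriangle, cell, ← image_smul, image_image]; rfl

lemma dist_vertex {a b : Fin 3} (h : a ≠ b) : dist (vertex a) (vertex b) = 1 := by
  have h3 : Real.sqrt 3 ^ 2 = 3 := Real.sq_sqrt (by norm_num)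
  rw [EuclideanSpace.dist_eq, Real.sqrt_eq_one]
  fin_cases a <;> fin_cases b <;>
    simp [vertex, Real.dist_eq, sq_abs, div_pow, h3] at h ⊢ <;> norm_num

/-- The gasket lies in the convex hull of the three vertices, and a convex hull has the diameter of
its generating set. -/
lemma diam_compactGasket : Metric.diam compactGasket = 1 := by
  have hfin : (range vertex).Finite := finite_range _
  have hd : Metric.diam (convexHull ℝ (range vertex)) ≤ 1 := by
    rw [convexHull_diam]
    refine Metric.diam_le_of_forall_dist_le zero_le_one ?_
    rintro _ ⟨a, rfl⟩ _ ⟨b, rfl⟩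
    by_cases h : a = b
    · simp [h]
    · rw [dist_vertex h]
  have hsub : compactGasket ⊆ convexHull ℝ (range vertex) := by
    refine closure_minimal (iUnion_subset fun m => ?_) (hfin.isClosed_convexHull ℝ)
    induction m with
    | zero => exact subset_convexHull ℝ _
    | succ m ih =>
      intro x hx
      obtain ⟨j, y, hy, rfl⟩ := mem_iUnion.1 hx
      have := (convex_convexHull ℝ (range vertex)) (ih hy)
        (subset_convexHull ℝ _ (mem_range_self j)) (by norm_num : (0 : ℝ) ≤ 2⁻¹)
        (by norm_num : (0 : ℝ) ≤ 2⁻¹) (by norm_num)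
      rwa [← smul_add] at this
  refine le_antisymm ((Metric.diam_mono hsub
    (hfin.isCompact_convexHull ℝ).isBounded).trans hd) ?_
  rw [← dist_vertex (a := 0) (b := 1) (by decide)]
  exact Metric.dist_le_diam_of_mem isCompact_compactGasket.isBounded (vertex_mem 0) (vertex_mem 1)

lemma diam_dyadicTriangle (i : CellIndex) (n : ℤ) : Metric.diam (dyadicTriangle i n) = 2 ^ n := by
  have h : Subtype.val '' dyadicTriangle i n = cell i n := by
    rw [dyadicTriangle_eq, Subtype.image_preimage_coe,
      inter_eq_self_of_subset_right (cell_subset_infGasket i n)]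
  rw [← isometry_subtype_coe.diam_image, h, cell]
  have h2 : Metric.diam (((2 : ℝ) ^ n) • compactGasket) = 2 ^ n := by
    rw [diam_smul₀, diam_compactGasket, Real.norm_of_nonneg (by positivity), mul_one]
  rw [← h2, ← image_smul]
  refine congrArg ENNReal.toReal ?_
  have : ∀ {f g : Plane → Plane}, (∀ x y, dist (f x) (f y) = dist (g x) (g y)) →
      Metric.ediam (f '' compactGasket) ≤ Metric.ediam (g '' compactGasket) := by
    intro f g hfg
    refine Metric.ediam_le ?_
    rintro _ ⟨x, hx, rfl⟩ _ ⟨y, hy, rfl⟩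
    rw [edist_dist, hfg, ← edist_dist]
    exact Metric.edist_le_ediam_of_mem (mem_image_of_mem _ hx) (mem_image_of_mem _ hy)
  have hd : ∀ x y, dist (scaledCell i n x) (scaledCell i n y) =
      dist ((2 : ℝ) ^ n • x) ((2 : ℝ) ^ n • y) := by
    intro x y
    rw [dist_scaledCell, dist_smul₀, Real.norm_of_nonneg (by positivity)]
  exact le_antisymm (this hd) (this fun x y => (hd x y).symm)

/-! ### The measure, decomposed over the cells of any scale. -/

/-! ### Self-similarity of the measure -/

/-- The law of a sequence of independent uniform digits. -/
def addrMeasure : Measure (ℕ → Fin 3) :=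
  Measure.infinitePi fun _ : ℕ => (PMF.uniformOfFintype (Fin 3)).toMeasure

instance : IsProbabilityMeasure addrMeasure := by unfold addrMeasure; infer_instance

lemma measurable_consAddr (j : Fin 3) : Measurable (consAddr j) := by
  refine measurable_pi_lambda _ fun n => ?_
  cases n with
  | zero => exact measurable_const
  | succ n => exact measurable_pi_apply n

lemma uniform_apply (t : Set (Fin 3)) : (PMF.uniformOfFintype (Fin 3)).toMeasure t =
    ∑ j, (3⁻¹ : ℝ≥0∞) * t.indicator 1 j := by
  rw [PMF.toMeasure_apply_fintype]
  refine Finset.sum_congr rfl fun j _ => ?_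
  by_cases h : j ∈ t <;> simp [h]

lemma consAddr_preimage_pi (j : Fin 3) (s : Finset ℕ) (t : ℕ → Set (Fin 3)) :
    consAddr j ⁻¹' Set.pi s t = {_ω | 0 ∈ s → j ∈ t 0} ∩
      Set.pi (s.preimage (· + 1) (add_left_injective 1).injOn) fun n => t (n + 1) := by
  ext ω
  simp only [mem_preimage, Set.mem_pi, mem_inter_iff, Finset.coe_preimage]
  constructor
  · exact fun h => ⟨h 0, fun n hn => h (n + 1) hn⟩
  · rintro ⟨h0, h⟩ n hn
    cases n with
    | zero => exact h0 hn
    | succ n => exact h n hn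

-- Conditioning on the first digit. A product measure is determined by its values on boxes, so only
-- those are compared.
open scoped Classical in
lemma addrMeasure_eq_sum :
    addrMeasure = ∑ j, (3⁻¹ : ℝ≥0∞) • addrMeasure.map (consAddr j) := by
  symm
  refine Measure.eq_infinitePi _ fun s t ht => ?_
  have hm : MeasurableSet (Set.pi (s : Set ℕ) t) :=
    MeasurableSet.pi s.countable_toSet fun n _ => ht n
  set s' : Finset ℕ := s.preimage (· + 1) (add_left_injective 1).injOn with hs'
  have hprod : ∀ j, addrMeasure (consAddr j ⁻¹' Set.pi s t) = (if 0 ∈ s → j ∈ t 0 then 1 else 0) *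
      ∏ n ∈ s', (PMF.uniformOfFintype (Fin 3)).toMeasure (t (n + 1)) := by
    intro j
    rw [consAddr_preimage_pi]
    split_ifs with h
    · have hu : {_ω : ℕ → Fin 3 | 0 ∈ s → j ∈ t 0} = univ := eq_univ_of_forall fun _ => h
      rw [one_mul, hu, univ_inter]
      exact Measure.infinitePi_pi _ fun n _ => ht (n + 1)
    · simp [h]
  simp only [Measure.coe_finsetSum, Measure.coe_smul, Finset.sum_apply, Pi.smul_apply,
    Measure.map_apply (measurable_consAddr _) hm, hprod, smul_eq_mul, ← mul_assoc]
  rw [← Finset.sum_mul]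
  have hmap : ∏ n ∈ s', (PMF.uniformOfFintype (Fin 3)).toMeasure (t (n + 1)) =
      ∏ n ∈ s.erase 0, (PMF.uniformOfFintype (Fin 3)).toMeasure (t n) := by
    refine Finset.prod_bij (fun n _ => n + 1) ?_ ?_ ?_ ?_
    · intro n hn; simpa [hs'] using hn
    · intro a _ b _ h; simpa using h
    · intro n hn
      obtain ⟨m, rfl⟩ := Nat.exists_eq_succ_of_ne_zero (Finset.ne_of_mem_erase hn)
      exact ⟨m, by simpa [hs'] using hn, rfl⟩
    · intro n _; rfl
  rw [hmap]
  by_cases h0 : 0 ∈ s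
  · rw [← Finset.mul_prod_erase s _ h0, uniform_apply]
    congr 1
    refine Finset.sum_congr rfl fun j _ => ?_
    by_cases hj : j ∈ t 0
    · simp [hj]
    · simp [h0, hj]
  · rw [Finset.erase_eq_of_notMem h0]
    simp only [h0, false_imp_iff, if_true, mul_one]
    rw [Finset.sum_const, Finset.card_univ, Fintype.card_fin, nsmul_eq_mul, Nat.cast_ofNat,
      ENNReal.mul_inv_cancel (by norm_num) (by norm_num), one_mul]

lemma gasketMeasure_eq_map : gasketMeasure = addrMeasure.map coding := rfl

lemma measurable_coding : Measurable coding := by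
  refine measurable_of_tendsto_metrizable (f := fun m ω => iterContraction m ω 0) ?_
    (tendsto_pi_nhds.2 fun ω => tendsto_iterContraction ω 0)
  intro m
  simp_rw [iterContraction_eq]
  refine measurable_const.add (Finset.measurable_sum _ fun n _ => ?_)
  have h : Measurable fun ω : ℕ → Fin 3 => vertex (ω n) :=
    (measurable_of_finite vertex).comp (measurable_pi_apply n)
  exact h.const_smul ((2⁻¹ : ℝ) ^ (n + 1))

instance : IsProbabilityMeasure gasketMeasure := by
  rw [gasketMeasure_eq_map]
  exact Measure.isProbabilityMeasure_map measurable_coding.aemeasurable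

lemma gasketMeasure_eq_sum :
    gasketMeasure = ∑ j, (3⁻¹ : ℝ≥0∞) • gasketMeasure.map (contraction j) := by
  conv_lhs => rw [gasketMeasure_eq_map, addrMeasure_eq_sum]
  rw [← Measure.mapₗ_apply_of_measurable measurable_coding, map_sum]
  refine Finset.sum_congr rfl fun j _ => ?_
  rw [map_smul, Measure.mapₗ_apply_of_measurable measurable_coding,
    Measure.map_map measurable_coding (measurable_consAddr j), gasketMeasure_eq_map,
    Measure.map_map (continuous_contraction j).measurable measurable_coding]
  congr 2
  exact funext fun ω => coding_cons j ω

lemma gasketMeasure_compl : gasketMeasure compactGasketᶜ = 0 := by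
  rw [gasketMeasure_eq_map, Measure.map_apply measurable_coding
    isCompact_compactGasket.isClosed.measurableSet.compl]
  have : coding ⁻¹' compactGasketᶜ = ∅ := by
    ext ω; simp [coding_mem ω]
  rw [this, measure_empty]

lemma gasketMeasure_compactGasket : gasketMeasure compactGasket = 1 := by
  rw [← prob_compl_eq_zero_iff isCompact_compactGasket.isClosed.measurableSet]
  exact gasketMeasure_compl

lemma gasketMeasure_apply_eq_sum {A : Set Plane} (hA : MeasurableSet A) :
    gasketMeasure A = ∑ j, 3⁻¹ * gasketMeasure (contraction j ⁻¹' A) := by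
  conv_lhs => rw [gasketMeasure_eq_sum]
  simp only [Measure.coe_finsetSum, Measure.coe_smul, Finset.sum_apply, Pi.smul_apply,
    Measure.map_apply (continuous_contraction _).measurable hA, smul_eq_mul]

/-- Only the contraction fixing `vertex a` reaches it from inside the gasket, so self-similarity
makes its mass equal to a third of itself. -/
lemma gasketMeasure_vertex (a : Fin 3) : gasketMeasure {vertex a} = 0 := by
  have h : ∀ j, gasketMeasure (contraction j ⁻¹' {vertex a}) =
      if j = a then gasketMeasure {vertex a} else 0 := by
    intro j
    split_ifs with hj
    · subst hj
      congr 1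
      ext x
      simp only [mem_preimage, mem_singleton_iff]
      conv_lhs => rw [← contraction_vertex_self j]
      exact (contraction_injective j).eq_iff
    · refine measure_mono_null (fun x hx => ?_) gasketMeasure_compl
      intro hxS
      have h1 := congrArg (bary a) (show contraction j x = vertex a from hx)
      rw [bary_contraction, bary_vertex, if_pos rfl, if_neg (Ne.symm hj)] at h1
      have := bary_le_one hxS a
      linarith
  have h2 := gasketMeasure_apply_eq_sum (measurableSet_singleton (vertex a))
  simp only [h, mul_ite, mul_zero, Finset.sum_ite_eq', Finset.mem_univ, if_true] at h2
  by_contra hne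
  have hfin : gasketMeasure {vertex a} ≠ ∞ := measure_ne_top _ _
  have h3 := congrArg ENNReal.toReal h2
  rw [ENNReal.toReal_mul] at h3
  have h4 := ENNReal.toReal_pos hne hfin
  rw [ENNReal.toReal_inv] at h3
  norm_num at h3
  linarith

/-! ### The measure of the infinite gasket -/

/-- The restriction of the measure of the infinite gasket to a cell, as a measure on the plane. -/
def cellMeasure (i : CellIndex) (n : ℤ) : Measure Plane :=
  (3 : ℝ≥0∞) ^ n • gasketMeasure.map (scaledCell i n)

/-- The measure of the infinite gasket, as a measure on the plane. -/
def planeMeasure : Measure Plane := Measure.sum fun i => cellMeasure i 0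

lemma three_zpow_ne_zero (n : ℤ) : (3 : ℝ≥0∞) ^ n ≠ 0 :=
  (ENNReal.zpow_pos (by norm_num) (by norm_num) n).ne'

lemma three_zpow_ne_top (n : ℤ) : (3 : ℝ≥0∞) ^ n ≠ ∞ :=
  (ENNReal.zpow_lt_top (by norm_num) (by norm_num) n).ne

lemma cellMeasure_eq_sum (i : CellIndex) (n : ℤ) :
    cellMeasure i n = ∑ j, cellMeasure (child i j) (n - 1) := by
  have hs := (continuous_scaledCell i n).measurable
  have h3 : (3 : ℝ≥0∞) ^ (n - 1) = 3 ^ n * 3⁻¹ := by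
    rw [ENNReal.zpow_sub (by norm_num) (by norm_num), zpow_one]
  unfold cellMeasure
  conv_lhs => rw [gasketMeasure_eq_sum]
  rw [← Measure.mapₗ_apply_of_measurable hs, map_sum, Finset.smul_sum]
  refine Finset.sum_congr rfl fun j _ => ?_
  rw [map_smul, Measure.mapₗ_apply_of_measurable hs,
    Measure.map_map hs (continuous_contraction j).measurable, smul_smul, h3]
  congr 2
  exact funext fun x => scaledCell_contraction i n j x

lemma sum_cellMeasure_sub_one (n : ℤ) :
    Measure.sum (fun i => cellMeasure i (n - 1)) = Measure.sum fun i => cellMeasure i n := by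
  ext A hA
  rw [Measure.sum_apply _ hA, Measure.sum_apply _ hA, ← tsum_child]
  refine tsum_congr fun i => ?_
  rw [cellMeasure_eq_sum i n, Measure.coe_finsetSum, Finset.sum_apply]

/-- The defining sum over unit cells may be replaced by a sum over cells of any size, which makes
the estimates available at every scale. -/
lemma planeMeasure_eq_sum (n : ℤ) : planeMeasure = Measure.sum fun i => cellMeasure i n := by
  induction n using Int.induction_on with
  | zero => rfl
  | succ n ih => rw [ih]; simpa using sum_cellMeasure_sub_one ((n : ℤ) + 1)
  | pred n ih => rw [sum_cellMeasure_sub_one, ih]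

lemma cellMeasure_apply (i : CellIndex) (n : ℤ) {A : Set Plane} (hA : MeasurableSet A) :
    cellMeasure i n A = 3 ^ n * gasketMeasure (scaledCell i n ⁻¹' A) := by
  rw [cellMeasure, Measure.smul_apply, smul_eq_mul,
    Measure.map_apply (continuous_scaledCell i n).measurable hA]

lemma cellMeasure_compl (i : CellIndex) (n : ℤ) : cellMeasure i n (cell i n)ᶜ = 0 := by
  rw [cellMeasure_apply i n (measurableSet_cell i n).compl]
  have : gasketMeasure (scaledCell i n ⁻¹' (cell i n)ᶜ) = 0 := by
    refine measure_mono_null (fun x hx => ?_) gasketMeasure_compl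
    refine fun hxS => hx ?_
    exact mem_image_of_mem _ hxS
  rw [this, mul_zero]

lemma ae_cellMeasure_mem (i : CellIndex) (n : ℤ) : ∀ᵐ p ∂cellMeasure i n, p ∈ cell i n :=
  cellMeasure_compl i n

lemma cellMeasure_univ (i : CellIndex) (n : ℤ) : cellMeasure i n univ = 3 ^ n := by
  rw [cellMeasure_apply i n MeasurableSet.univ]; simp

/-- Distinct cells meet only in vertices, which are null. -/
lemma cellMeasure_cell (i i' : CellIndex) (n : ℤ) :
    cellMeasure i n (cell i' n) = if i = i' then 3 ^ n else 0 := by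
  rw [cellMeasure_apply i n (measurableSet_cell i' n)]
  split_ifs with h
  · subst h
    rw [cell, (scaledCell_injective i n).preimage_image, gasketMeasure_compactGasket, mul_one]
  · have : gasketMeasure (scaledCell i n ⁻¹' cell i' n) = 0 := by
      have hnull : gasketMeasure (compactGasketᶜ ∪ ⋃ a, {vertex a}) = 0 :=
        measure_union_null gasketMeasure_compl (measure_iUnion_null gasketMeasure_vertex)
      refine measure_mono_null (fun x hx => ?_) hnull
      by_cases hxS : x ∈ compactGasket
      · obtain ⟨y, hy, hxy⟩ := hx
        obtain ⟨a, rfl⟩ := exists_vertex_of_scaledCell_eq hxS hy h hxy.symm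
        exact Or.inr (mem_iUnion.2 ⟨a, rfl⟩)
      · exact Or.inl hxS
    rw [this, mul_zero]

lemma planeMeasure_cell (i : CellIndex) (n : ℤ) : planeMeasure (cell i n) = 3 ^ n := by
  rw [planeMeasure_eq_sum n, Measure.sum_apply _ (measurableSet_cell i n)]
  simp only [cellMeasure_cell, tsum_ite_eq]

lemma cellMeasure_le (i : CellIndex) (n : ℤ) : cellMeasure i n ≤ planeMeasure := by
  rw [planeMeasure_eq_sum n]; exact Measure.le_sum _ i

lemma measurableEmbedding_val : MeasurableEmbedding (Subtype.val : infGasket → Plane) :=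
  MeasurableEmbedding.subtype_coe isClosed_infGasket.measurableSet

/-- The plane measure is carried by the gasket, so restricting it and pushing it back loses nothing.
-/
lemma map_nuHat : nuHat.map Subtype.val = planeMeasure := by
  have h0 : (Measure.sum fun i : CellIndex => gasketMeasure.map (cellMap i)) = planeMeasure := by
    unfold planeMeasure cellMeasure
    congr 1
    ext1 i
    rw [zpow_zero, one_smul]
    congr 1
    exact funext fun x => by simp [scaledCell]
  rw [nuHat, h0, measurableEmbedding_val.map_comap, Subtype.range_coe]
  refine Measure.restrict_eq_self_of_ae_mem ?_
  rw [planeMeasure]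
  refine (Measure.ae_sum_iff' isClosed_infGasket.measurableSet).2 ?_
  intro i
  filter_upwards [ae_cellMeasure_mem i 0] with p hp
  exact cell_subset_infGasket i 0 hp

lemma nuHat_preimage (A : Set Plane) : nuHat (Subtype.val ⁻¹' A) = planeMeasure A := by
  rw [← map_nuHat, measurableEmbedding_val.map_apply]

lemma nuHat_dyadicTriangle (i : CellIndex) (n : ℤ) : nuHat (dyadicTriangle i n) = 3 ^ n := by
  rw [dyadicTriangle_eq, nuHat_preimage, planeMeasure_cell]

/-! ### Localised energy and the oscillation estimate. -/

/-! ### Energy on cells -/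

/-- The sum of `(f a - f b)²` over ordered pairs. -/
def pairEnergy (f : Fin 3 → ℝ) : ℝ := ∑ a, ∑ b, (f a - f b) ^ 2

lemma pairEnergy_nonneg (f : Fin 3 → ℝ) : 0 ≤ pairEnergy f :=
  Finset.sum_nonneg fun _ _ => Finset.sum_nonneg fun _ _ => sq_nonneg _

lemma sq_sub_le_pairEnergy (f : Fin 3 → ℝ) (a b : Fin 3) : (f a - f b) ^ 2 ≤ pairEnergy f :=
  (Finset.single_le_sum (f := fun b => (f a - f b) ^ 2) (fun _ _ => sq_nonneg _)
    (Finset.mem_univ b)).trans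
  (Finset.single_le_sum (f := fun a => ∑ b, (f a - f b) ^ 2)
    (fun _ _ => Finset.sum_nonneg fun _ _ => sq_nonneg _) (Finset.mem_univ a))

/-- Among all choices of the three midpoint values the energy of the subtriangles is smallest for
the harmonic one, where it is exactly 3/5 of the original. -/
lemma pairEnergy_le_sum {f : Fin 3 → ℝ} {g : Fin 3 → Fin 3 → ℝ} (h : ∀ j, g j j = f j)
    (hg : ∀ j k, g j k = g k j) : pairEnergy f ≤ 5 / 3 * ∑ j, pairEnergy (g j) := by
  simp only [pairEnergy, Fin.sum_univ_three, h, hg 1 0, hg 2 0, hg 2 1]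
  generalize f 0 = a
  generalize f 1 = b
  generalize f 2 = c
  generalize g 0 1 = x
  generalize g 0 2 = y
  generalize g 1 2 = z
  -- The squares measure deviations from the harmonic midpoint values `(2a + 2b + c)/5`, and so on,
  -- where equality holds.
  nlinarith [sq_nonneg (x - (2 * a + 2 * b + c) / 5), sq_nonneg (y - (2 * a + b + 2 * c) / 5),
    sq_nonneg (z - (a + 2 * b + 2 * c) / 5),
    sq_nonneg (x - (2 * a + 2 * b + c) / 5 - (y - (2 * a + b + 2 * c) / 5)),
    sq_nonneg (x - (2 * a + 2 * b + c) / 5 - (z - (a + 2 * b + 2 * c) / 5)),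
    sq_nonneg (y - (2 * a + b + 2 * c) / 5 - (z - (a + 2 * b + 2 * c) / 5))]

/-- The values of a function at the vertices of a cell. -/
def vertexValues (U : Plane → ℝ) (i : CellIndex) (n : ℤ) (a : Fin 3) : ℝ :=
  U (scaledCell i n (vertex a))

/-- The renormalised energy of the vertex values on a cell. -/
def cellEnergy (U : Plane → ℝ) (i : CellIndex) (n : ℤ) : ℝ≥0∞ :=
  ENNReal.ofReal ((5 / 3) ^ (-n) * pairEnergy (vertexValues U i n))

/-- The energy of the cells of side `2ⁿ⁻ᵏ` inside a cell of side `2ⁿ`. -/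
def subEnergy (U : Plane → ℝ) : ℕ → CellIndex → ℤ → ℝ≥0∞
  | 0, i, n => cellEnergy U i n
  | k + 1, i, n => ∑ j, subEnergy U k (child i j) (n - 1)

/-- The energy of a function inside a cell. -/
def limEnergy (U : Plane → ℝ) (i : CellIndex) (n : ℤ) : ℝ≥0∞ := ⨆ k, subEnergy U k i n

lemma cellEnergy_le_sum (U : Plane → ℝ) (i : CellIndex) (n : ℤ) :
    cellEnergy U i n ≤ ∑ j, cellEnergy U (child i j) (n - 1) := by
  unfold cellEnergy
  rw [← ENNReal.ofReal_sum_of_nonneg fun j _ => mul_nonneg (by positivity) (pairEnergy_nonneg _),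
    ← Finset.mul_sum]
  refine ENNReal.ofReal_le_ofReal ?_
  have h := pairEnergy_le_sum (f := vertexValues U i n)
    (g := fun j => vertexValues U (child i j) (n - 1))
    (fun j => by
      simp only [vertexValues]
      rw [← scaledCell_contraction, contraction_vertex_self])
    (fun j k => by
      simp only [vertexValues]
      rw [← scaledCell_contraction, ← scaledCell_contraction, contraction_vertex_comm])
  have hr : (5 / 3 : ℝ) ^ (-(n - 1)) = (5 / 3) ^ (-n) * (5 / 3) := by
    rw [← zpow_add_one₀ (by norm_num)]; congr 1; ring
  rw [hr, mul_assoc]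
  exact mul_le_mul_of_nonneg_left h (by positivity)

lemma subEnergy_le_succ (U : Plane → ℝ) (k : ℕ) (i : CellIndex) (n : ℤ) :
    subEnergy U k i n ≤ subEnergy U (k + 1) i n := by
  induction k generalizing i n with
  | zero => exact cellEnergy_le_sum U i n
  | succ k ih => exact Finset.sum_le_sum fun j _ => ih _ _

lemma subEnergy_mono (U : Plane → ℝ) (i : CellIndex) (n : ℤ) :
    Monotone fun k => subEnergy U k i n :=
  monotone_nat_of_le_succ fun k => subEnergy_le_succ U k i n

lemma cellEnergy_le_limEnergy (U : Plane → ℝ) (i : CellIndex) (n : ℤ) :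
    cellEnergy U i n ≤ limEnergy U i n := le_iSup (fun k => subEnergy U k i n) 0

lemma limEnergy_child_le (U : Plane → ℝ) (i : CellIndex) (n : ℤ) (j : Fin 3) :
    limEnergy U (child i j) (n - 1) ≤ limEnergy U i n := by
  refine iSup_le fun k => le_trans ?_ (le_iSup (fun k => subEnergy U k i n) (k + 1))
  exact Finset.single_le_sum (f := fun j => subEnergy U k (child i j) (n - 1))
    (fun _ _ => zero_le) (Finset.mem_univ j)

lemma tsum_subEnergy (U : Plane → ℝ) (k : ℕ) (n : ℤ) :
    ∑' i, subEnergy U k i n = ∑' i, cellEnergy U i (n - k) := by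
  induction k generalizing n with
  | zero => simp [subEnergy]
  | succ k ih =>
    simp only [subEnergy]
    rw [tsum_child fun i => subEnergy U k i (n - 1), ih, Nat.cast_succ, sub_sub, add_comm 1]

lemma tsum_cellEnergy_antitone (U : Plane → ℝ) : Antitone fun n : ℤ => ∑' i, cellEnergy U i n := by
  refine antitone_int_of_succ_le fun n => ?_
  rw [← tsum_child fun i => cellEnergy U i n]
  refine ENNReal.tsum_le_tsum fun i => ?_
  simpa using cellEnergy_le_sum U i (n + 1)

/-- Energies increase under refinement, so the supremum over levels commutes with finite sums, and
each level is dominated by a finer one of the form `-m`. -/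
lemma tsum_limEnergy_le {U : Plane → ℝ} {B : ℝ≥0∞} (h : ∀ m : ℕ, ∑' i, cellEnergy U i (-m) ≤ B)
    (n : ℤ) : ∑' i, limEnergy U i n ≤ B := by
  rw [ENNReal.tsum_eq_iSup_sum]
  refine iSup_le fun s => ?_
  simp only [limEnergy]
  rw [ENNReal.finsetSum_iSup_of_monotone fun i => subEnergy_mono U i n]
  refine iSup_le fun k => (ENNReal.sum_le_tsum s).trans ?_
  rw [tsum_subEnergy]
  exact (tsum_cellEnergy_antitone U (by omega : -((n - k).natAbs : ℤ) ≤ n - k)).trans (h _)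

/-! ### Comparison with the Dirichlet form -/

/-- The extension by zero of a function on the infinite gasket to the plane. -/
def extendZero (u : infGasket → ℝ) : Plane → ℝ := Function.extend Subtype.val u 0

lemma extendZero_coe (u : infGasket → ℝ) (p : infGasket) : extendZero u p = u p :=
  Subtype.val_injective.extend_apply u 0 p

/-- The vertex of a cell as a point of the infinite gasket. -/
def cellVertex (n : ℤ) (i : CellIndex) (a : Fin 3) : infGasket :=
  ⟨scaledCell i n (vertex a), scaledCell_mem (vertex_mem a)⟩

lemma vertexValues_extendZero (u : infGasket → ℝ) (i : CellIndex) (n : ℤ) (a : Fin 3) :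
    vertexValues (extendZero u) i n a = u (cellVertex n i a) :=
  extendZero_coe u (cellVertex n i a)

lemma mem_smul_cellMap_iff {m : ℕ} {i : CellIndex} {x : infGasket} :
    (x : Plane) ∈ ((2⁻¹ : ℝ) ^ m) • (cellMap i '' V 0) ↔ ∃ a, x = cellVertex (-m) i a := by
  rw [← image_smul, image_image, V, ← range_comp]
  simp only [mem_range, Function.comp_apply, cellVertex, Subtype.ext_iff, scaledCell, zpow_neg,
    zpow_natCast, inv_pow, eq_comm]

lemma cellVertex_ne (n : ℤ) (i : CellIndex) {a b : Fin 3} (h : a ≠ b) :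
    cellVertex n i a ≠ cellVertex n i b := by
  intro h'
  have := dist_vertex h
  rw [scaledCell_injective i n (congrArg Subtype.val h'), dist_self] at this
  exact zero_ne_one this

lemma cellEnergy_eq_sum (U : Plane → ℝ) (i : CellIndex) (n : ℤ) : cellEnergy U i n =
    ∑ a, ∑ b, ENNReal.ofReal ((5 / 3) ^ (-n) * (vertexValues U i n a - vertexValues U i n b) ^ 2) := by
  simp only [cellEnergy, pairEnergy, Finset.mul_sum]
  rw [ENNReal.ofReal_sum_of_nonneg fun _ _ => Finset.sum_nonneg fun _ _ => by positivity]
  exact Finset.sum_congr rfl fun _ _ => ENNReal.ofReal_sum_of_nonneg fun _ _ => by positivity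

/-- Each adjacent pair is assigned one cell and two labels that produce it; the assignment is
injective. -/
lemma energyApprox_le_tsum (u : infGasket → ℝ) (m : ℕ) :
    energyApprox m u ≤ ∑' i, cellEnergy (extendZero u) i (-m) := by
  have hex : ∀ e : {e : infGasket × infGasket // Adj m e.1 e.2}, ∃ c : CellIndex × Fin 3 × Fin 3,
      e.1 = (cellVertex (-m) c.1 c.2.1, cellVertex (-m) c.1 c.2.2) := by
    rintro ⟨⟨x, y⟩, _, i, hx, hy⟩
    obtain ⟨a, rfl⟩ := mem_smul_cellMap_iff.1 hx
    obtain ⟨b, rfl⟩ := mem_smul_cellMap_iff.1 hy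
    exact ⟨(i, a, b), rfl⟩
  choose c hc using hex
  have hinj : Function.Injective c := fun e e' h => Subtype.ext <| by rw [hc, hc, h]
  set g : CellIndex × Fin 3 × Fin 3 → ℝ≥0∞ := fun c =>
    ENNReal.ofReal ((5 / 3) ^ m * (u (cellVertex (-m) c.1 c.2.1) - u (cellVertex (-m) c.1 c.2.2)) ^ 2)
    with hg
  calc energyApprox m u ≤ ∑' e, g (c e) := by
        refine ENNReal.tsum_le_tsum fun e => ENNReal.ofReal_le_ofReal ?_
        rw [hc e]
        refine mul_le_mul_of_nonneg_right ?_ (sq_nonneg _)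
        have : (0 : ℝ) < (5 / 3) ^ m := by positivity
        linarith
    _ ≤ ∑' c, g c := ENNReal.tsum_comp_le_tsum_of_injective hinj g
    _ = ∑' i, ∑' ab : Fin 3 × Fin 3, g (i, ab) := ENNReal.tsum_prod (f := fun i ab => g (i, ab))
    _ = _ := by
        refine tsum_congr fun i => ?_
        rw [tsum_fintype, Fintype.sum_prod_type, cellEnergy_eq_sum]
        simp only [hg, vertexValues_extendZero, neg_neg, zpow_natCast]

/-- For a fixed sign and fixed distinct labels a cell is determined by its pair of vertices. There
are 3·3·2 choices of labels and sign, and the weight 1/2 in `energyApprox` doubles this to 36. -/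
lemma tsum_cellEnergy_le (u : infGasket → ℝ) (m : ℕ) :
    ∑' i, cellEnergy (extendZero u) i (-m) ≤ 36 * energyApprox m u := by
  have key : ∀ (a b : Fin 3) (s : ℤˣ), ∑' o : ℕ →₀ Fin 3, ENNReal.ofReal ((5 / 3) ^ m *
      (u (cellVertex (-m) (s, o) a) - u (cellVertex (-m) (s, o) b)) ^ 2) ≤ 2 * energyApprox m u := by
    intro a b s
    by_cases hab : a = b
    · simp [hab]
    · rw [energyApprox, ← ENNReal.tsum_mul_left]
      let c : (ℕ →₀ Fin 3) → {e : infGasket × infGasket // Adj m e.1 e.2} := fun o =>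
        ⟨(cellVertex (-m) (s, o) a, cellVertex (-m) (s, o) b), cellVertex_ne _ _ hab, (s, o),
          mem_smul_cellMap_iff.2 ⟨a, rfl⟩, mem_smul_cellMap_iff.2 ⟨b, rfl⟩⟩
      have hinj : Function.Injective c := by
        intro o o' h
        have h1 := congrArg (fun e => (e.1.1 : Plane)) h
        have := eq_of_scaledCell_vertex_eq (i := (s, o)) (i' := (s, o')) rfl h1
        exact (Prod.mk.inj this).2
      refine le_trans (le_of_eq ?_) (ENNReal.tsum_comp_le_tsum_of_injective hinj _)
      refine tsum_congr fun o => ?_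
      have h2 : (2 : ℝ≥0∞) = ENNReal.ofReal 2 := by simp
      rw [h2, ← ENNReal.ofReal_mul (by norm_num)]
      congr 1
      simp only [c]
      ring
  have hswap : ∑' i, cellEnergy (extendZero u) i (-m) = ∑ a, ∑ b, ∑ s : ℤˣ, ∑' o : ℕ →₀ Fin 3,
      ENNReal.ofReal ((5 / 3) ^ m *
      (u (cellVertex (-m) (s, o) a) - u (cellVertex (-m) (s, o) b)) ^ 2) := by
    simp only [cellEnergy_eq_sum, vertexValues_extendZero, neg_neg, zpow_natCast]
    rw [Summable.tsum_finsetSum fun _ _ => ENNReal.summable]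
    refine Finset.sum_congr rfl fun a _ => ?_
    rw [Summable.tsum_finsetSum fun _ _ => ENNReal.summable]
    refine Finset.sum_congr rfl fun b _ => ?_
    rw [ENNReal.tsum_prod (f := fun s o => ENNReal.ofReal ((5 / 3) ^ m *
      (u (cellVertex (-m) (s, o) a) - u (cellVertex (-m) (s, o) b)) ^ 2)), tsum_fintype]
  rw [hswap]
  calc _ ≤ ∑ _a : Fin 3, ∑ _b : Fin 3, ∑ _s : ℤˣ, 2 * energyApprox m u :=
        Finset.sum_le_sum fun a _ => Finset.sum_le_sum fun b _ => Finset.sum_le_sum fun s _ =>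
          key a b s
    _ = _ := by
        simp only [Finset.sum_const, Finset.card_univ, Fintype.card_fin, Fintype.card_units_int,
          nsmul_eq_mul, ← mul_assoc]
        norm_num

lemma tsum_limEnergy_le_energy (u : infGasket → ℝ) (n : ℤ) :
    ∑' i, limEnergy (extendZero u) i n ≤ 36 * energy u :=
  tsum_limEnergy_le (fun m => (tsum_cellEnergy_le u m).trans <|
    mul_le_mul_right (le_iSup (fun m => energyApprox m u) m) _) n

/-! ### Oscillation on cells -/

lemma continuousOn_extendZero {u : infGasket → ℝ} (hu : Continuous u) :
    ContinuousOn (extendZero u) infGasket := by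
  rw [continuousOn_iff_continuous_domRestrict]
  convert hu using 1
  exact funext fun p => extendZero_coe u p

/-- The exact ratio is `√(3/5)`, and 3/5 ≤ 16/25; a rational ratio below 1 is enough for the
telescoping. -/
lemma sqrt_zpow_sub_one_le (n : ℤ) {e : ℝ} (he : 0 ≤ e) :
    Real.sqrt ((5 / 3) ^ (n - 1) * e) ≤ 4 / 5 * Real.sqrt ((5 / 3) ^ n * e) := by
  rw [zpow_sub_one₀ (by norm_num)]
  refine Real.sqrt_le_iff.2 ⟨by positivity, ?_⟩
  rw [mul_pow, Real.sq_sqrt (by positivity)]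
  have : (0 : ℝ) ≤ (5 / 3) ^ n * e := by positivity
  norm_num
  nlinarith

lemma abs_vertexValues_sub_le {U : Plane → ℝ} {i : CellIndex} {n : ℤ} {e : ℝ} (he : 0 ≤ e)
    (h : limEnergy U i n ≤ ENNReal.ofReal e) (a b : Fin 3) :
    |vertexValues U i n a - vertexValues U i n b| ≤ Real.sqrt ((5 / 3) ^ n * e) := by
  have h1 := (ENNReal.ofReal_le_ofReal_iff he).1 ((cellEnergy_le_limEnergy U i n).trans h)
  refine Real.abs_le_sqrt ((sq_sub_le_pairEnergy _ a b).trans ?_)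
  rwa [zpow_neg, inv_mul_le_iff₀ (by positivity)] at h1

/-- Telescoping in inductive form: move inside the child, cross the child to the vertex it shares
with the parent, then cross the parent. The constant 10 closes the induction because 10·(4/5) + 4/5
+ 1 ≤ 10. -/
lemma abs_iterContraction_sub_le {U : Plane → ℝ} {e : ℝ} (he : 0 ≤ e) (m : ℕ) :
    ∀ (i : CellIndex) (n : ℤ) (ω : ℕ → Fin 3), limEnergy U i n ≤ ENNReal.ofReal e →
      |U (scaledCell i n (iterContraction m ω (vertex 0))) - U (scaledCell i n (vertex 0))| ≤
        10 * Real.sqrt ((5 / 3) ^ n * e) := by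
  induction m with
  | zero => intro i n ω _; simp only [iterContraction, sub_self, abs_zero]; positivity
  | succ m ih =>
    intro i n ω h
    have hc := (limEnergy_child_le U i n (ω 0)).trans h
    have h1 := ih (child i (ω 0)) (n - 1) (tailAddr ω) hc
    have h2 := abs_vertexValues_sub_le he hc 0 (ω 0)
    have h3 := abs_vertexValues_sub_le he h (ω 0) 0
    have h4 := sqrt_zpow_sub_one_le n he
    have h5 : vertexValues U (child i (ω 0)) (n - 1) (ω 0) = vertexValues U i n (ω 0) := by
      rw [vertexValues, ← scaledCell_contraction, contraction_vertex_self]; rfl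
    rw [h5] at h2
    simp only [vertexValues] at h2 h3
    rw [iterContraction, scaledCell_contraction]
    rw [abs_le] at *
    constructor <;> linarith [h1.1, h1.2, h2.1, h2.2, h3.1, h3.2]

/-- The oscillation of a function on a cell is controlled by its energy on the cell. -/
lemma abs_scaledCell_sub_le {U : Plane → ℝ} (hU : ContinuousOn U infGasket) {e : ℝ} (he : 0 ≤ e)
    {i : CellIndex} {n : ℤ} (h : limEnergy U i n ≤ ENNReal.ofReal e) {x y : Plane}
    (hx : x ∈ compactGasket) (hy : y ∈ compactGasket) :
    |U (scaledCell i n x) - U (scaledCell i n y)| ≤ 20 * Real.sqrt ((5 / 3) ^ n * e) := by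
  have key : ∀ x ∈ compactGasket, |U (scaledCell i n x) - U (scaledCell i n (vertex 0))| ≤
      10 * Real.sqrt ((5 / 3) ^ n * e) := by
    intro x hx
    rw [compactGasket_eq_range] at hx
    obtain ⟨ω, rfl⟩ := hx
    have hm : ∀ m, iterContraction m ω (vertex 0) ∈ compactGasket := fun m =>
      subset_closure (mem_iUnion.2 ⟨m, iterContraction_vertex_mem m ω 0⟩)
    have ht : Tendsto (fun m => scaledCell i n (iterContraction m ω (vertex 0))) atTop
        (𝓝[infGasket] (scaledCell i n (coding ω))) :=
      tendsto_nhdsWithin_iff.2 ⟨((continuous_scaledCell i n).tendsto _).comp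
        (tendsto_iterContraction ω (vertex 0)), Eventually.of_forall fun m => scaledCell_mem (hm m)⟩
    have h1 := (hU _ (scaledCell_mem (coding_mem ω))).tendsto.comp ht
    exact le_of_tendsto (h1.sub_const _).abs
      (Eventually.of_forall fun m => abs_iterContraction_sub_le he m i n ω h)
  have h1 := key x hx
  have h2 := key y hy
  rw [abs_le] at *
  constructor <;> linarith [h1.1, h1.2, h2.1, h2.2]

/-! ### The Sobolev inequality: one scale, then the best scale. -/

/-! ### Sums of powers -/

lemma tsum_rpow_le_rpow_tsum {ι : Type*} (x : ι → ℝ≥0∞) {t : ℝ} (ht : 1 ≤ t) :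
    ∑' i, x i ^ t ≤ (∑' i, x i) ^ t := by
  have h : ∀ y : ℝ≥0∞, y ^ t = y * y ^ (t - 1) := by
    intro y
    conv_lhs => rw [show t = 1 + (t - 1) by ring]
    rw [ENNReal.rpow_add_of_nonneg _ _ zero_le_one (by linarith), ENNReal.rpow_one]
  rw [h (∑' i, x i), ← ENNReal.tsum_mul_right]
  refine ENNReal.tsum_le_tsum fun i => ?_
  rw [h (x i)]
  exact mul_le_mul_right (ENNReal.rpow_le_rpow (ENNReal.le_tsum i) (by linarith)) _

lemma tsum_rpow_le_rpow_tsum_rpow {ι : Type*} (x : ι → ℝ≥0∞) {r t : ℝ} (hr : 0 < r)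
    (hrt : r ≤ t) : ∑' i, x i ^ t ≤ (∑' i, x i ^ r) ^ (t / r) := by
  refine le_trans (le_of_eq ?_) (tsum_rpow_le_rpow_tsum _ ((one_le_div hr).2 hrt))
  refine tsum_congr fun i => ?_
  rw [← ENNReal.rpow_mul, mul_div_cancel₀ _ hr.ne']

/-! ### Pointwise bounds -/

/-- A bound for the oscillation of a function on a cell. -/
def oscBound (U : Plane → ℝ) (i : CellIndex) (n : ℤ) : ℝ≥0∞ :=
  (400 * ENNReal.ofReal ((5 / 3) ^ n) * limEnergy U i n) ^ (1 / 2 : ℝ)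

lemma enorm_scaledCell_le {U : Plane → ℝ} (hU : ContinuousOn U infGasket) (i : CellIndex) (n : ℤ)
    {x y : Plane} (hx : x ∈ compactGasket) (hy : y ∈ compactGasket) :
    ‖U (scaledCell i n x)‖ₑ ≤ oscBound U i n + ‖U (scaledCell i n y)‖ₑ := by
  by_cases htop : limEnergy U i n = ∞
  · have : oscBound U i n = ∞ := by
      rw [oscBound, htop, ENNReal.mul_top, ENNReal.top_rpow_of_pos (by norm_num)]
      exact mul_ne_zero (by norm_num) (ENNReal.ofReal_pos.2 (by positivity)).ne'
    rw [this, top_add]; exact le_top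
  have h := abs_scaledCell_sub_le hU (ENNReal.toReal_nonneg (a := limEnergy U i n))
    (ENNReal.ofReal_toReal htop).ge hx hy
  have hosc : oscBound U i n =
      ENNReal.ofReal (20 * Real.sqrt ((5 / 3) ^ n * (limEnergy U i n).toReal)) := by
    rw [oscBound]
    conv_lhs => rw [← ENNReal.ofReal_toReal htop]
    rw [show (400 : ℝ≥0∞) = ENNReal.ofReal 400 by simp, ← ENNReal.ofReal_mul (by norm_num),
      ← ENNReal.ofReal_mul (by positivity), ENNReal.ofReal_rpow_of_nonneg
        (mul_nonneg (by positivity) ENNReal.toReal_nonneg) (by norm_num), ← Real.sqrt_eq_rpow,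
      mul_assoc, Real.sqrt_mul (by norm_num)]
    congr 2
    rw [show (400 : ℝ) = 20 ^ 2 by norm_num, Real.sqrt_sq (by norm_num)]
  rw [hosc, Real.enorm_eq_ofReal_abs, Real.enorm_eq_ofReal_abs,
    ← ENNReal.ofReal_add (by positivity) (abs_nonneg _)]
  refine ENNReal.ofReal_le_ofReal ?_
  have := abs_sub_abs_le_abs_sub (U (scaledCell i n x)) (U (scaledCell i n y))
  linarith

/-- The contribution of the `L^p` norm to the supremum on a cell. -/
def meanBound (U : Plane → ℝ) (p : ℝ≥0∞) (i : CellIndex) (n : ℤ) : ℝ≥0∞ :=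
  (3 : ℝ≥0∞) ^ (-n * p⁻¹.toReal) * eLpNorm U p (cellMeasure i n)

lemma three_rpow_ne_top (t : ℝ) : (3 : ℝ≥0∞) ^ t ≠ ∞ :=
  ENNReal.rpow_ne_top_of_ne_zero (by norm_num) (by norm_num)

lemma three_rpow_add (s t : ℝ) : (3 : ℝ≥0∞) ^ (s + t) = 3 ^ s * 3 ^ t :=
  ENNReal.rpow_add _ _ (by norm_num) (by norm_num)

lemma three_zpow_rpow (n : ℤ) (t : ℝ) : ((3 : ℝ≥0∞) ^ n) ^ t = 3 ^ ((n : ℝ) * t) := by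
  rw [← ENNReal.rpow_intCast, ← ENNReal.rpow_mul]

/-- If `|U|` exceeds its oscillation bound by `c` at one point, then `|U| ≥ c` on the whole cell.
The `L^p` norm there is thus at least that of the constant `c`, namely `c · 3^(n/p)`. -/
lemma enorm_scaledCell_le_add {U : Plane → ℝ} (hU : ContinuousOn U infGasket) {p : ℝ≥0∞}
    (hp : p ≠ 0) (i : CellIndex) (n : ℤ) {x : Plane} (hx : x ∈ compactGasket) :
    ‖U (scaledCell i n x)‖ₑ ≤ oscBound U i n + meanBound U p i n := by
  rw [← tsub_le_iff_left]
  set c := ‖U (scaledCell i n x)‖ₑ - oscBound U i n with hc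
  have hctop : c ≠ ∞ := ne_top_of_le_ne_top enorm_ne_top tsub_le_self
  have hce : ‖c.toReal‖ₑ = c := by
    rw [Real.enorm_eq_ofReal ENNReal.toReal_nonneg, ENNReal.ofReal_toReal hctop]
  have h1 : eLpNorm (fun _ => c.toReal) p (cellMeasure i n) ≤ eLpNorm U p (cellMeasure i n) := by
    refine eLpNorm_mono_enorm_ae ?_
    filter_upwards [ae_cellMeasure_mem i n] with q hq
    obtain ⟨y, hy, rfl⟩ := hq
    rw [hce, hc, tsub_le_iff_left]
    exact enorm_scaledCell_le hU i n hx hy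
  have hne : cellMeasure i n ≠ 0 := by
    intro h
    have := cellMeasure_univ i n
    rw [h] at this
    exact three_zpow_ne_zero n this.symm
  rw [eLpNorm_const _ hp hne, hce, cellMeasure_univ, three_zpow_rpow, one_div,
    ← ENNReal.toReal_inv] at h1
  calc c = (3 : ℝ≥0∞) ^ (-n * p⁻¹.toReal) * (c * 3 ^ (n * p⁻¹.toReal)) := by
        rw [mul_left_comm, ← three_rpow_add, neg_mul, neg_add_cancel, ENNReal.rpow_zero, mul_one]
    _ ≤ _ := mul_le_mul_right h1 _

lemma tsum_oscBound_sq_le (u : infGasket → ℝ) (n : ℤ) :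
    ∑' i, oscBound (extendZero u) i n ^ (2 : ℝ) ≤
      400 * ENNReal.ofReal ((5 / 3) ^ n) * (36 * energy u) := by
  simp only [oscBound, ← ENNReal.rpow_mul]
  norm_num only [ENNReal.rpow_one]
  rw [ENNReal.tsum_mul_left]
  exact mul_le_mul_right (tsum_limEnergy_le_energy u n) _

lemma oscBound_le (u : infGasket → ℝ) (i : CellIndex) (n : ℤ) : oscBound (extendZero u) i n ≤
    (400 * ENNReal.ofReal ((5 / 3) ^ n) * (36 * energy u)) ^ (1 / 2 : ℝ) := by
  refine ENNReal.rpow_le_rpow (mul_le_mul_right ?_ _) (by norm_num)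
  exact (ENNReal.le_tsum i).trans (tsum_limEnergy_le_energy u n)

lemma eLpNorm_extendZero (u : infGasket → ℝ) (p : ℝ≥0∞) :
    eLpNorm (extendZero u) p planeMeasure = eLpNorm u p nuHat := by
  rw [← map_nuHat, measurableEmbedding_val.eLpNorm_map_measure]
  congr 1
  exact funext fun x => extendZero_coe u x

lemma meanBound_le (u : infGasket → ℝ) (p : ℝ≥0∞) (i : CellIndex) (n : ℤ) :
    meanBound (extendZero u) p i n ≤ 3 ^ (-n * p⁻¹.toReal) * eLpNorm u p nuHat := by
  rw [← eLpNorm_extendZero]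
  exact mul_le_mul_right (eLpNorm_mono_measure _ (cellMeasure_le i n)) _

lemma tsum_meanBound_rpow (u : infGasket → ℝ) {p : ℝ≥0∞} (hp : p ≠ 0) (hp' : p ≠ ∞) (n : ℤ) :
    ∑' i, meanBound (extendZero u) p i n ^ p.toReal =
      (3 ^ (-n * p⁻¹.toReal) * eLpNorm u p nuHat) ^ p.toReal := by
  have hp0 : 0 < p.toReal := ENNReal.toReal_pos hp hp'
  simp only [meanBound, ENNReal.mul_rpow_of_nonneg _ _ hp0.le]
  rw [ENNReal.tsum_mul_left, ← eLpNorm_extendZero]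
  congr 1
  have h : ∀ μ : Measure Plane, eLpNorm (extendZero u) p μ ^ p.toReal =
      ∫⁻ x, ‖extendZero u x‖ₑ ^ p.toReal ∂μ := by
    intro μ
    rw [eLpNorm_eq_lintegral_rpow_enorm_toReal hp hp', ← ENNReal.rpow_mul,
      one_div_mul_cancel hp0.ne', ENNReal.rpow_one]
  simp only [h]
  rw [planeMeasure_eq_sum n, lintegral_sum_measure]

/-! ### The inequality at a fixed scale -/

/-- The global step: the oscillations lie in `ℓ²` and the local norms in `ℓ^p`, and both spaces
embed in `ℓ^q` with norm one. -/
lemma eLpNorm_le_of_cell_le {u : infGasket → ℝ} (hu : Continuous u) {p q : ℝ≥0∞} (hp : 1 ≤ p)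
    (hpq : p ≤ q) (hq : 2 ≤ q) {σ : Measure infGasket} {n : ℤ} {w : ℝ≥0∞}
    (hσ : ∀ i, σ (dyadicTriangle i n) ≤ w) :
    eLpNorm u q σ ≤ 2 * w ^ q⁻¹.toReal *
      ((400 * ENNReal.ofReal ((5 / 3) ^ n) * (36 * energy u)) ^ (1 / 2 : ℝ) +
        3 ^ (-n * p⁻¹.toReal) * eLpNorm u p nuHat) := by
  set O := (400 * ENNReal.ofReal ((5 / 3) ^ n) * (36 * energy u)) ^ (1 / 2 : ℝ) with hO
  set B := (3 : ℝ≥0∞) ^ (-n * p⁻¹.toReal) * eLpNorm u p nuHat with hB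
  have hp0 : p ≠ 0 := (zero_lt_one.trans_le hp).ne'
  have hU := continuousOn_extendZero hu
  have hpt : ∀ i, ∀ z ∈ dyadicTriangle i n,
      ‖u z‖ₑ ≤ oscBound (extendZero u) i n + meanBound (extendZero u) p i n := by
    intro i z hz
    rw [dyadicTriangle_eq] at hz
    obtain ⟨x, hx, hxz⟩ := hz
    rw [← extendZero_coe u z, ← hxz]
    exact enorm_scaledCell_le_add hU hp0 i n hx
  have hcov : ∀ z : infGasket, ∃ i, z ∈ dyadicTriangle i n := by
    intro z
    obtain ⟨i, x, hx, h⟩ := exists_eq_scaledCell n z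
    exact ⟨i, by rw [dyadicTriangle_eq]; exact ⟨x, hx, h⟩⟩
  rcases eq_or_ne q ∞ with rfl | hq'
  · rw [eLpNorm_exponent_top]
    refine (eLpNormEssSup_le_of_ae_enorm_bound (C := O + B) (Eventually.of_forall fun z => ?_)).trans
      ?_
    · obtain ⟨i, hi⟩ := hcov z
      exact (hpt i z hi).trans (add_le_add (oscBound_le u i n) (meanBound_le u p i n))
    · simp only [ENNReal.inv_top, ENNReal.toReal_zero, ENNReal.rpow_zero, mul_one]
      exact le_mul_of_one_le_left zero_le one_le_two
  · have hp' : p ≠ ∞ := ne_top_of_le_ne_top hq' hpq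
    have hq0 : q ≠ 0 := (two_pos.trans_le hq).ne'
    have hpr : 0 < p.toReal := ENNReal.toReal_pos hp0 hp'
    have hq2 : 2 ≤ q.toReal := by
      simpa using ENNReal.toReal_mono hq' hq
    have hqr : 0 < q.toReal := by linarith
    have hpqr : p.toReal ≤ q.toReal := ENNReal.toReal_mono hq' hpq
    have h1 : ∑' i, oscBound (extendZero u) i n ^ q.toReal ≤ O ^ q.toReal := by
      refine (tsum_rpow_le_rpow_tsum_rpow _ two_pos hq2).trans ?_
      rw [hO, ← ENNReal.rpow_mul, one_div_mul_eq_div]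
      exact ENNReal.rpow_le_rpow (tsum_oscBound_sq_le u n) (by positivity)
    have h2 : ∑' i, meanBound (extendZero u) p i n ^ q.toReal ≤ B ^ q.toReal := by
      refine (tsum_rpow_le_rpow_tsum_rpow _ hpr hpqr).trans ?_
      rw [tsum_meanBound_rpow u hp0 hp', ← ENNReal.rpow_mul, mul_div_cancel₀ _ hpr.ne']
    have h3 : ∫⁻ z, ‖u z‖ₑ ^ q.toReal ∂σ ≤ w * ((2 * (O + B)) ^ q.toReal) := by
      calc ∫⁻ z, ‖u z‖ₑ ^ q.toReal ∂σ
          = ∫⁻ z in ⋃ i, dyadicTriangle i n, ‖u z‖ₑ ^ q.toReal ∂σ := by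
            rw [iUnion_eq_univ_iff.2 hcov, setLIntegral_univ]
        -- `σ` may charge the common vertices of cells; subadditivity over the cover is enough.
        _ ≤ ∑' i, ∫⁻ z in dyadicTriangle i n, ‖u z‖ₑ ^ q.toReal ∂σ := lintegral_iUnion_le _ _
        _ ≤ ∑' i, w * (2 ^ q.toReal * (oscBound (extendZero u) i n ^ q.toReal +
              meanBound (extendZero u) p i n ^ q.toReal)) := by
            refine ENNReal.tsum_le_tsum fun i => ?_
            have hm : MeasurableSet (dyadicTriangle i n) := by
              rw [dyadicTriangle_eq]; exact measurable_subtype_coe (measurableSet_cell i n)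
            have hadd : ∀ a b : ℝ≥0∞, (a + b) ^ q.toReal ≤
                2 ^ q.toReal * (a ^ q.toReal + b ^ q.toReal) := by
              intro a b
              have hmax : (a + b) ^ q.toReal ≤ (2 * max a b) ^ q.toReal := by
                refine ENNReal.rpow_le_rpow ?_ hqr.le
                rw [two_mul]
                exact add_le_add (le_max_left _ _) (le_max_right _ _)
              refine hmax.trans ?_
              rw [ENNReal.mul_rpow_of_nonneg _ _ hqr.le]
              refine mul_le_mul_right ?_ _
              rcases max_choice a b with h | h <;> rw [h]
              · exact le_self_add
              · exact le_add_self
            calc ∫⁻ z in dyadicTriangle i n, ‖u z‖ₑ ^ q.toReal ∂σ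
                ≤ ∫⁻ _ in dyadicTriangle i n, (oscBound (extendZero u) i n +
                    meanBound (extendZero u) p i n) ^ q.toReal ∂σ :=
                  setLIntegral_mono' hm fun z hz => ENNReal.rpow_le_rpow (hpt i z hz) hqr.le
              _ = (oscBound (extendZero u) i n + meanBound (extendZero u) p i n) ^ q.toReal *
                    σ (dyadicTriangle i n) := setLIntegral_const _ _
              _ ≤ _ := by
                  rw [mul_comm]
                  exact mul_le_mul' (hσ i) (hadd _ _)
        _ = w * (2 ^ q.toReal * (∑' i, oscBound (extendZero u) i n ^ q.toReal +
              ∑' i, meanBound (extendZero u) p i n ^ q.toReal)) := by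
            rw [ENNReal.tsum_mul_left, ENNReal.tsum_mul_left, ENNReal.tsum_add]
        _ ≤ w * (2 ^ q.toReal * (O + B) ^ q.toReal) := by
            refine mul_le_mul_right (mul_le_mul_right ?_ _) _
            exact (add_le_add h1 h2).trans (ENNReal.add_rpow_le_rpow_add _ _ (by linarith))
        _ = _ := by rw [ENNReal.mul_rpow_of_nonneg _ _ hqr.le]
    rw [eLpNorm_eq_lintegral_rpow_enorm_toReal hq0 hq']
    refine (ENNReal.rpow_le_rpow h3 (by positivity)).trans (le_of_eq ?_)
    rw [ENNReal.mul_rpow_of_nonneg _ _ (by positivity), ← ENNReal.rpow_mul,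
      mul_one_div_cancel hqr.ne', ENNReal.rpow_one, ENNReal.toReal_inv, one_div]
    ring

/-! ### Exponents -/

lemma one_div_two_mul_deltaS : 1 / (2 * deltaS) = (Real.log 5 / Real.log 3 - 1) / 2 := by
  have h3 : Real.log 3 ≠ 0 := (Real.log_pos (by norm_num)).ne'
  have h5 : Real.log 5 ≠ 0 := (Real.log_pos (by norm_num)).ne'
  have h : 2 / spectralDim = Real.log 5 / Real.log 3 := by
    rw [spectralDim]; field_simp
  rw [deltaS, h, one_div, mul_inv, inv_inv]
  ring

lemma one_div_two_mul_deltaS_pos : 0 < 1 / (2 * deltaS) := by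
  rw [one_div_two_mul_deltaS]
  have h3 : 0 < Real.log 3 := Real.log_pos (by norm_num)
  have : 1 < Real.log 5 / Real.log 3 :=
    (one_lt_div h3).2 (Real.log_lt_log (by norm_num) (by norm_num))
  linarith

lemma five_thirds_zpow (n : ℤ) : (5 / 3 : ℝ) ^ n = 3 ^ (2 * (n * (1 / (2 * deltaS)))) := by
  have h3 : Real.log 3 ≠ 0 := (Real.log_pos (by norm_num)).ne'
  have h : (5 / 3 : ℝ) = 3 ^ (2 * (1 / (2 * deltaS))) := by
    rw [one_div_two_mul_deltaS, Real.rpow_def_of_pos (by norm_num),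
      show Real.log 3 * (2 * ((Real.log 5 / Real.log 3 - 1) / 2)) = Real.log 5 - Real.log 3 by
        field_simp, Real.exp_sub, Real.exp_log (by norm_num), Real.exp_log (by norm_num)]
  rw [← Real.rpow_intCast, h, ← Real.rpow_mul (by norm_num)]
  congr 1; ring

lemma ofReal_five_thirds_zpow (n : ℤ) :
    ENNReal.ofReal ((5 / 3) ^ n) = 3 ^ (2 * (n * (1 / (2 * deltaS)))) := by
  rw [five_thirds_zpow, ← ENNReal.ofReal_rpow_of_pos (by norm_num)]
  simp

/-- The constant is free of `p` and `q` because `K^(1/q) ≤ K` for `K ≥ 1`; here 240 = 2·120 and 120²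
= 400·36. -/
lemma eLpNorm_le_of_cell_le_rpow {u : infGasket → ℝ} (hu : Continuous u) {p q : ℝ≥0∞} (hp : 1 ≤ p)
    (hpq : p ≤ q) (hq : 2 ≤ q) {σ : Measure infGasket} {n : ℤ} {K : ℝ≥0} (hK : 1 ≤ K) {d : ℝ}
    (hσ : ∀ i, σ (dyadicTriangle i n) ≤ K * ((3 : ℝ≥0∞) ^ n) ^ d) :
    eLpNorm u q σ ≤ 240 * K * 3 ^ (n * (q⁻¹.toReal * d)) *
      (3 ^ (n * (1 / (2 * deltaS))) * energy u ^ (1 / 2 : ℝ) +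
        3 ^ (-(n * p⁻¹.toReal)) * eLpNorm u p nuHat) := by
  refine (eLpNorm_le_of_cell_le hu hp hpq hq hσ).trans ?_
  have hq1 : q⁻¹.toReal ≤ 1 := by
    have : q⁻¹ ≤ 1 := ENNReal.inv_le_one.2 (one_le_two.trans hq)
    simpa using ENNReal.toReal_mono ENNReal.one_ne_top this
  have hw : (K * ((3 : ℝ≥0∞) ^ n) ^ d) ^ q⁻¹.toReal ≤ K * 3 ^ (n * (q⁻¹.toReal * d)) := by
    rw [ENNReal.mul_rpow_of_nonneg _ _ ENNReal.toReal_nonneg, three_zpow_rpow, ← ENNReal.rpow_mul]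
    refine mul_le_mul' ?_ (le_of_eq (by ring_nf))
    conv_rhs => rw [← ENNReal.rpow_one (K : ℝ≥0∞)]
    exact ENNReal.rpow_le_rpow_of_exponent_le (by exact_mod_cast hK) hq1
  have hO : (400 * ENNReal.ofReal ((5 / 3) ^ n) * (36 * energy u)) ^ (1 / 2 : ℝ) =
      120 * (3 ^ (n * (1 / (2 * deltaS))) * energy u ^ (1 / 2 : ℝ)) := by
    have h120 : (14400 : ℝ≥0∞) ^ (1 / 2 : ℝ) = 120 := by
      rw [show (14400 : ℝ≥0∞) = 120 ^ (2 : ℝ) by norm_num, ← ENNReal.rpow_mul]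
      norm_num
    rw [show 400 * ENNReal.ofReal ((5 / 3) ^ n) * (36 * energy u) =
      14400 * (ENNReal.ofReal ((5 / 3) ^ n) * energy u) by ring,
      ENNReal.mul_rpow_of_nonneg _ _ (by norm_num), ENNReal.mul_rpow_of_nonneg _ _ (by norm_num),
      h120, ofReal_five_thirds_zpow, ← ENNReal.rpow_mul]
    congr 3; ring
  rw [hO]
  calc _ ≤ 2 * (K * 3 ^ (n * (q⁻¹.toReal * d))) *
        (120 * (3 ^ (n * (1 / (2 * deltaS))) * energy u ^ (1 / 2 : ℝ)) +
          120 * (3 ^ (-(n * p⁻¹.toReal)) * eLpNorm u p nuHat)) := by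
        refine mul_le_mul' (mul_le_mul_right hw _) (add_le_add le_rfl ?_)
        rw [neg_mul]
        exact le_mul_of_one_le_left zero_le (by norm_num)
    _ = _ := by ring

/-! ### Optimisation over scales -/

/-- Choosing the scale `n` that balances the two terms of the inequality. -/
lemma balanced_scale_le {s d θ α β z : ℝ} (hθ : 0 < s + θ) (hdθ : 0 ≤ d + θ) (h0 : 0 ≤ s - d)
    (h1 : s - d ≤ 1) (hz : z = (β - α) / (s + θ)) :
    (3 : ℝ) ^ (⌊z⌋ * d) * (3 ^ (⌊z⌋ * θ) * 3 ^ α + 3 ^ (-(⌊z⌋ * s)) * 3 ^ β) ≤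
      6 * ((3 : ℝ) ^ α) ^ ((s - d) / (s + θ)) * (3 ^ β) ^ (1 - (s - d) / (s + θ)) := by
  have h3 : (0 : ℝ) < 3 := by norm_num
  -- At the real scale `z` both terms equal `3^(β - z(s-d))`, which is the interpolated product.
  -- Rounding `z` down cannot increase the first and costs the second a factor at most 3; allowing 3
  -- for each gives 6.
  have hα : α = β - z * (s + θ) := by rw [hz]; field_simp; ring
  have hexp : α * ((s - d) / (s + θ)) + β * (1 - (s - d) / (s + θ)) = β - z * (s - d) := by
    rw [hα]; field_simp; ring
  have hR : ((3 : ℝ) ^ α) ^ ((s - d) / (s + θ)) * (3 ^ β) ^ (1 - (s - d) / (s + θ)) =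
      3 ^ (β - z * (s - d)) := by
    rw [← Real.rpow_mul h3.le, ← Real.rpow_mul h3.le, ← Real.rpow_add h3, hexp]
  rw [mul_assoc 6, hR, mul_add, ← Real.rpow_add h3, ← Real.rpow_add h3, ← Real.rpow_add h3, ← Real.rpow_add h3]
  have hf := Int.floor_le z
  have hf' := Int.lt_floor_add_one z
  have e1 : (3 : ℝ) ^ (⌊z⌋ * d + (⌊z⌋ * θ + α)) ≤ 3 ^ (β - z * (s - d) + 1) := by
    refine Real.rpow_le_rpow_of_exponent_le (by norm_num) ?_
    rw [hα]
    nlinarith [mul_le_mul_of_nonneg_right hf hdθ]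
  have e2 : (3 : ℝ) ^ (⌊z⌋ * d + (-(⌊z⌋ * s) + β)) ≤ 3 ^ (β - z * (s - d) + 1) := by
    refine Real.rpow_le_rpow_of_exponent_le (by norm_num) ?_
    nlinarith [mul_le_mul_of_nonneg_right (by linarith : z - ⌊z⌋ ≤ 1) h0]
  rw [Real.rpow_add_one h3.ne'] at e1 e2
  linarith

/-- The balanced scale is negative exactly when `A > B`; then the small-scale exponent applies,
otherwise the large-scale one. -/
lemma le_of_forall_scale {s dlo dup θ A B : ℝ} (hA : 0 < A) (hB : 0 < B) (hθ : 0 < θ) (hs : 0 ≤ s)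
    (hs1 : s ≤ 1) (hlo : 0 ≤ dlo) (hup : 0 ≤ dup) (hsup : dup ≤ s) {X c : ℝ} (hc : 0 ≤ c)
    (h1 : ∀ n : ℤ, n < 0 → X ≤ c * 3 ^ (n * dup) * (3 ^ (n * θ) * A + 3 ^ (-(n * s)) * B))
    (h2 : ∀ n : ℤ, 0 ≤ n → X ≤ c * 3 ^ (n * dlo) * (3 ^ (n * θ) * A + 3 ^ (-(n * s)) * B)) :
    X ≤ 6 * c * (A ^ max ((s - dup) / (s + θ)) 0 * B ^ (1 - max ((s - dup) / (s + θ)) 0) +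
      A ^ max ((s - dlo) / (s + θ)) 0 * B ^ (1 - max ((s - dlo) / (s + θ)) 0)) := by
  have h3 : (0 : ℝ) < 3 := by norm_num
  have hsθ : 0 < s + θ := by linarith
  obtain ⟨α, rfl⟩ : ∃ α, A = (3 : ℝ) ^ α := ⟨Real.logb 3 A, by
    rw [Real.rpow_logb h3 (by norm_num) hA]⟩
  obtain ⟨β, rfl⟩ : ∃ β, B = (3 : ℝ) ^ β := ⟨Real.logb 3 B, by
    rw [Real.rpow_logb h3 (by norm_num) hB]⟩
  have hpos : ∀ a : ℝ, 0 ≤ ((3 : ℝ) ^ α) ^ a * ((3 : ℝ) ^ β) ^ (1 - a) := fun a => by positivity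
  have key : ∀ d, 0 ≤ d → 0 ≤ s - d →
      X ≤ c * 3 ^ ((⌊(β - α) / (s + θ)⌋ : ℝ) * d) * (3 ^ ((⌊(β - α) / (s + θ)⌋ : ℝ) * θ) * 3 ^ α +
        3 ^ (-((⌊(β - α) / (s + θ)⌋ : ℝ) * s)) * 3 ^ β) →
      X ≤ 6 * c * (((3 : ℝ) ^ α) ^ max ((s - d) / (s + θ)) 0 *
        ((3 : ℝ) ^ β) ^ (1 - max ((s - d) / (s + θ)) 0)) := by
    intro d hd hsd hX
    have := balanced_scale_le (α := α) (β := β) hsθ (by linarith : 0 ≤ d + θ) hsd (by linarith) rfl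
    rw [max_eq_left (div_nonneg hsd hsθ.le)]
    have h4 := mul_le_mul_of_nonneg_left this hc
    refine hX.trans (le_trans (le_of_eq (by ring)) (h4.trans (le_of_eq (by ring))))
  by_cases hz : (β - α) / (s + θ) < 0
  · have hfl : ⌊(β - α) / (s + θ)⌋ < 0 := Int.floor_lt.2 (by simpa using hz)
    have := key dup hup (by linarith) (h1 _ hfl)
    have h5 := mul_nonneg (mul_nonneg (by norm_num : (0 : ℝ) ≤ 6) hc)
      (hpos (max ((s - dlo) / (s + θ)) 0))
    linarith
  · have hz' : 0 ≤ (β - α) / (s + θ) := not_lt.1 hz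
    have h5 := mul_nonneg (mul_nonneg (by norm_num : (0 : ℝ) ≤ 6) hc)
      (hpos (max ((s - dup) / (s + θ)) 0))
    by_cases hsd : 0 ≤ s - dlo
    · have := key dlo hlo hsd (h2 _ (Int.floor_nonneg.2 hz'))
      linarith
    -- When `dlo > s` the positive part is zero, and the unit scale suffices: a nonnegative balanced
    -- scale means `A ≤ B`, so the bound is at most `2cB`.
    · have hmax : max ((s - dlo) / (s + θ)) 0 = 0 :=
        max_eq_right (div_nonpos_of_nonpos_of_nonneg (by linarith) hsθ.le)
      have h6 := h2 0 le_rfl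
      simp only [Int.cast_zero, zero_mul, neg_zero, Real.rpow_zero, mul_one, one_mul] at h6
      have hαβ : (3 : ℝ) ^ α ≤ 3 ^ β := by
        refine Real.rpow_le_rpow_of_exponent_le (by norm_num) ?_
        have := (le_div_iff₀ hsθ).1 hz'
        linarith
      rw [hmax, Real.rpow_zero, sub_zero, Real.rpow_one, one_mul]
      have h7 : c * ((3 : ℝ) ^ α + 3 ^ β) ≤ 6 * c * 3 ^ β := by
        have : 0 ≤ c * (3 : ℝ) ^ β := by positivity
        nlinarith [mul_le_mul_of_nonneg_left hαβ hc]
      linarith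

/-! ### The Sobolev inequality -/

lemma toReal_mul_inv {q δ : ℝ≥0∞} (hq : q ≠ 0) (hδ : δ ≠ 0) :
    (q * δ)⁻¹.toReal = q⁻¹.toReal * δ⁻¹.toReal := by
  rw [ENNReal.mul_inv (Or.inl hq) (Or.inr hδ), ENNReal.toReal_mul]

lemma two_zpow_lt_one_iff {n : ℤ} : (2 : ℝ) ^ n < 1 ↔ n < 0 := by
  rw [← zpow_zero (2 : ℝ)]
  exact zpow_lt_zpow_iff_right₀ one_lt_two

lemma DyadicUpperRegular.le_of_neg {σ : Measure infGasket} {K : ℝ≥0} {δlo δup : ℝ≥0∞}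
    (h : DyadicUpperRegular σ K δlo δup) {n : ℤ} (hn : n < 0) (i : CellIndex) :
    σ (dyadicTriangle i n) ≤ K * ((3 : ℝ≥0∞) ^ n) ^ δup⁻¹.toReal := by
  have := (h _ ⟨i, n, rfl⟩).1
  rw [diam_dyadicTriangle, nuHat_dyadicTriangle] at this
  exact this (by positivity) (two_zpow_lt_one_iff.2 hn)

lemma DyadicUpperRegular.le_of_nonneg {σ : Measure infGasket} {K : ℝ≥0} {δlo δup : ℝ≥0∞}
    (h : DyadicUpperRegular σ K δlo δup) {n : ℤ} (hn : 0 ≤ n) (i : CellIndex) :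
    σ (dyadicTriangle i n) ≤ K * ((3 : ℝ≥0∞) ^ n) ^ δlo⁻¹.toReal := by
  have := (h _ ⟨i, n, rfl⟩).2
  rw [diam_dyadicTriangle, nuHat_dyadicTriangle] at this
  exact this (one_le_zpow₀ one_le_two hn)

/-- A function of finite norm and zero energy vanishes. -/
lemma eq_zero_of_energy_eq_zero {u : infGasket → ℝ} (hu : Continuous u) (hL : MemLp u 2 nuHat)
    (h : energy u = 0) : u = 0 := by
  -- Without energy the oscillation term drops out, and the mean term decays like `3^(-n/2)` on
  -- growing cells.
  have hpt : ∀ z, ∀ n : ℤ, ‖u z‖ₑ ≤ 3 ^ (-(n : ℝ) * (2 : ℝ≥0∞)⁻¹.toReal) * eLpNorm u 2 nuHat := by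
    intro z n
    obtain ⟨i, x, hx, hxz⟩ := exists_eq_scaledCell n z
    have h1 := enorm_scaledCell_le_add (continuousOn_extendZero hu) two_ne_zero i n hx
    rw [hxz, extendZero_coe] at h1
    refine h1.trans (le_trans (add_le_add (oscBound_le u i n) (meanBound_le u 2 i n)) ?_)
    rw [h, mul_zero, mul_zero, ENNReal.zero_rpow_of_pos (by norm_num), zero_add]
  have hlim : Tendsto (fun n : ℕ => (3 : ℝ≥0∞) ^ (-((n : ℤ) : ℝ) * (2 : ℝ≥0∞)⁻¹.toReal) *
      eLpNorm u 2 nuHat) atTop (𝓝 0) := by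
    have hr : (3 : ℝ≥0∞) ^ (-(2 : ℝ≥0∞)⁻¹.toReal) < 1 := by
      refine ENNReal.rpow_lt_one_of_one_lt_of_neg (by norm_num) ?_
      norm_num
    have := ENNReal.Tendsto.mul_const (ENNReal.tendsto_pow_atTop_nhds_zero_of_lt_one hr)
      (Or.inr hL.eLpNorm_ne_top)
    rw [zero_mul] at this
    refine this.congr fun n => ?_
    rw [← ENNReal.rpow_natCast, ← ENNReal.rpow_mul]
    congr 2
    push_cast; ring
  funext z
  have := ge_of_tendsto hlim (Eventually.of_forall fun n : ℕ => hpt z n)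
  simpa using this

lemma ofReal_three_rpow (t : ℝ) : ENNReal.ofReal ((3 : ℝ) ^ t) = 3 ^ t := by
  rw [← ENNReal.ofReal_rpow_of_pos (by norm_num)]; simp

theorem sobolevInequality_of_dyadicUpperRegular {K : ℝ≥0} (hK : 1 ≤ K) {p q δlo δup : ℝ≥0∞}
    {σ : Measure infGasket} (hp : 1 ≤ p) (hpq : p ≤ q) (hq : 2 ≤ q) (hlo : 0 < δlo)
    (hlu : δlo ≤ δup) (hup : 1 ≤ δup) (hσ : DyadicUpperRegular σ K δlo δup) :
    SobolevInequality σ p q (1440 * K) ![sobolevExponent p q δup, sobolevExponent p q δlo] := by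
  rintro u ⟨hE, hL⟩
  simp only [Fin.sum_univ_two, Matrix.cons_val_zero, Matrix.cons_val_one]
  have hu := u.continuous
  rcases eq_or_ne (energy u) 0 with hE0 | hE0
  · rw [eq_zero_of_energy_eq_zero hu hL hE0, eLpNorm_zero]; exact zero_le
  have hq0 : q ≠ 0 := (two_pos.trans_le hq).ne'
  have hup0 : δup ≠ 0 := (hlo.trans_le hlu).ne'
  set s := p⁻¹.toReal with hs
  set θ := 1 / (2 * deltaS) with hθ
  set dup := q⁻¹.toReal * δup⁻¹.toReal with hdup
  set dlo := q⁻¹.toReal * δlo⁻¹.toReal with hdlo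
  have hθ0 : 0 < θ := one_div_two_mul_deltaS_pos
  have hp1 : p⁻¹ ≤ 1 := ENNReal.inv_le_one.2 hp
  have hs0 : 0 ≤ s := ENNReal.toReal_nonneg
  have hs1 : s ≤ 1 := by simpa [hs] using ENNReal.toReal_mono ENNReal.one_ne_top hp1
  have hdup0 : 0 ≤ dup := mul_nonneg ENNReal.toReal_nonneg ENNReal.toReal_nonneg
  have hdlo0 : 0 ≤ dlo := mul_nonneg ENNReal.toReal_nonneg ENNReal.toReal_nonneg
  have hups : dup ≤ s := by
    have h1 : q⁻¹.toReal ≤ s := ENNReal.toReal_mono (ne_top_of_le_ne_top ENNReal.one_ne_top hp1)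
      (ENNReal.inv_le_inv.2 hpq)
    have h2 : δup⁻¹.toReal ≤ 1 := by
      simpa using ENNReal.toReal_mono ENNReal.one_ne_top (ENNReal.inv_le_one.2 hup)
    exact (mul_le_of_le_one_right ENNReal.toReal_nonneg h2).trans h1
  have e1 : sobolevExponent p q δup = max ((s - dup) / (s + θ)) 0 := by
    rw [sobolevExponent, toReal_mul_inv hq0 hup0]
  have e2 : sobolevExponent p q δlo = max ((s - dlo) / (s + θ)) 0 := by
    rw [sobolevExponent, toReal_mul_inv hq0 hlo.ne']
  have h1 : ∀ n : ℤ, n < 0 → eLpNorm u q σ ≤ 240 * K * 3 ^ (n * dup) *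
      (3 ^ (n * θ) * energy u ^ (1 / 2 : ℝ) + 3 ^ (-(n * s)) * eLpNorm u p nuHat) := fun n hn =>
    eLpNorm_le_of_cell_le_rpow hu hp hpq hq hK fun i => hσ.le_of_neg hn i
  have h2 : ∀ n : ℤ, 0 ≤ n → eLpNorm u q σ ≤ 240 * K * 3 ^ (n * dlo) *
      (3 ^ (n * θ) * energy u ^ (1 / 2 : ℝ) + 3 ^ (-(n * s)) * eLpNorm u p nuHat) := fun n hn =>
    eLpNorm_le_of_cell_le_rpow hu hp hpq hq hK fun i => hσ.le_of_nonneg hn i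
  have hEA : ∀ a : ℝ, energy u ^ (a / 2) = (energy u ^ (1 / 2 : ℝ)) ^ a := fun a => by
    rw [← ENNReal.rpow_mul]; congr 1; ring
  rw [e1, e2, hEA (max ((s - dup) / (s + θ)) 0), hEA (max ((s - dlo) / (s + θ)) 0)]
  have hA0 : energy u ^ (1 / 2 : ℝ) ≠ 0 := (ENNReal.rpow_pos (pos_iff_ne_zero.2 hE0) hE.ne).ne'
  have hAtop : energy u ^ (1 / 2 : ℝ) ≠ ∞ := ENNReal.rpow_ne_top_of_nonneg (by norm_num) hE.ne
  generalize energy u ^ (1 / 2 : ℝ) = A at h1 h2 hA0 hAtop ⊢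
  have hK0 : (K : ℝ≥0∞) ≠ 0 := by
    have : K ≠ 0 := (zero_lt_one.trans_le hK).ne'
    exact_mod_cast this
  rcases eq_or_ne (eLpNorm u p nuHat) ∞ with hB | hB
  · rw [hB]
    -- As `θ > 0`, the norm enters with a positive power, so the right-hand side is infinite as
    -- well.
    have ha : max ((s - dup) / (s + θ)) 0 < 1 :=
      max_lt ((div_lt_one (by linarith)).2 (by linarith)) one_pos
    rw [ENNReal.top_rpow_of_pos (sub_pos.2 ha), ENNReal.mul_top
      (ENNReal.rpow_pos (pos_iff_ne_zero.2 hA0) hAtop).ne', top_add, ENNReal.mul_top]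
    · exact le_top
    · push_cast
      exact mul_ne_zero (by norm_num) hK0
  rcases eq_or_ne (eLpNorm u p nuHat) 0 with hB0 | hB0
  -- Only the energy term is left, and it tends to zero as the cells shrink.
  · have hlim : Tendsto (fun n : ℕ => (240 * K * A : ℝ≥0∞) * (3 ^ (-(dup + θ))) ^ n) atTop
        (𝓝 0) := by
      have hr : (3 : ℝ≥0∞) ^ (-(dup + θ)) < 1 :=
        ENNReal.rpow_lt_one_of_one_lt_of_neg (by norm_num) (by linarith)
      have := ENNReal.Tendsto.const_mul (a := 240 * K * A)
        (ENNReal.tendsto_pow_atTop_nhds_zero_of_lt_one hr)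
        (Or.inr (ENNReal.mul_ne_top (ENNReal.mul_ne_top (by norm_num) ENNReal.coe_ne_top) hAtop))
      rwa [mul_zero] at this
    have hle : eLpNorm u q σ ≤ 0 := by
      refine ge_of_tendsto hlim ?_
      filter_upwards [eventually_gt_atTop 0] with n hn
      refine (h1 (-(n : ℤ)) (by omega)).trans (le_of_eq ?_)
      rw [hB0, mul_zero, add_zero, ← ENNReal.rpow_natCast, ← ENNReal.rpow_mul,
        show -(dup + θ) * (n : ℝ) = ((-(n : ℤ) : ℤ) : ℝ) * dup + ((-(n : ℤ) : ℤ) : ℝ) * θ by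
          push_cast; ring, three_rpow_add]
      ring
    exact hle.trans zero_le
  generalize eLpNorm u p nuHat = B at h1 h2 hB hB0 ⊢
  have hA' := ENNReal.toReal_pos hA0 hAtop
  have hB' := ENNReal.toReal_pos hB0 hB
  have hconv : ∀ (n : ℤ) (d : ℝ), 240 * (K : ℝ≥0∞) * 3 ^ (n * d) *
      (3 ^ (n * θ) * A + 3 ^ (-(n * s)) * B) = ENNReal.ofReal (240 * K * 3 ^ (n * d) *
        (3 ^ (n * θ) * A.toReal + 3 ^ (-(n * s)) * B.toReal)) := by
    intro n d
    rw [ENNReal.ofReal_mul (by positivity), ENNReal.ofReal_mul (by positivity),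
      ENNReal.ofReal_mul (by positivity), ENNReal.ofReal_add (by positivity) (by positivity),
      ENNReal.ofReal_mul (by positivity), ENNReal.ofReal_mul (by positivity),
      ENNReal.ofReal_toReal hAtop, ENNReal.ofReal_toReal hB]
    simp only [ofReal_three_rpow, ENNReal.ofReal_coe_nnreal]
    norm_num
  have hXtop : eLpNorm u q σ ≠ ∞ := by
    have := h2 0 le_rfl
    rw [hconv] at this
    exact ne_top_of_le_ne_top ENNReal.ofReal_ne_top this
  have hreal : ∀ {n : ℤ} {d : ℝ}, eLpNorm u q σ ≤ 240 * (K : ℝ≥0∞) * 3 ^ (n * d) *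
      (3 ^ (n * θ) * A + 3 ^ (-(n * s)) * B) → (eLpNorm u q σ).toReal ≤ 240 * K * 3 ^ (n * d) *
        (3 ^ (n * θ) * A.toReal + 3 ^ (-(n * s)) * B.toReal) := by
    intro n d h
    rw [hconv] at h
    exact ENNReal.toReal_le_of_le_ofReal (by positivity) h
  have hfin := le_of_forall_scale (c := 240 * K) hA' hB' hθ0 hs0 hs1 hdlo0 hdup0 hups (by positivity)
    (fun n hn => hreal (h1 n hn)) (fun n hn => hreal (h2 n hn))
  have hrp : ∀ a : ℝ, A ^ a * B ^ (1 - a) = ENNReal.ofReal (A.toReal ^ a * B.toReal ^ (1 - a)) := by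
    intro a
    rw [ENNReal.ofReal_mul (by positivity), ← ENNReal.ofReal_rpow_of_pos hA',
      ← ENNReal.ofReal_rpow_of_pos hB', ENNReal.ofReal_toReal hAtop, ENNReal.ofReal_toReal hB]
  rw [hrp, hrp, ← ENNReal.ofReal_add (by positivity) (by positivity), ← ENNReal.ofReal_coe_nnreal,
    ← ENNReal.ofReal_mul (by positivity), ← ENNReal.ofReal_toReal hXtop]
  refine ENNReal.ofReal_le_ofReal (hfin.trans (le_of_eq ?_))
  push_cast
  ring

/-! ### Harmonic extension and the test functions built from it. -/

/-! ### Harmonic functions on the compact gasket -/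

/-- The vertex values on the `j`-th subtriangle of the harmonic function with vertex values `f`. -/
def harmChild (f : Fin 3 → ℝ) (j k : Fin 3) : ℝ :=
  if k = j then f j else (f j + f k + ∑ l, f l) / 5

lemma harmChild_self (f : Fin 3 → ℝ) (j : Fin 3) : harmChild f j j = f j := if_pos rfl

lemma harmChild_comm (f : Fin 3 → ℝ) (j k : Fin 3) : harmChild f j k = harmChild f k j := by
  by_cases h : k = j
  · rw [h]
  · rw [harmChild, harmChild, if_neg h, if_neg (Ne.symm h), add_comm (f j)]

/-- The equality case of `pairEnergy_le_sum`: renormalised energy is constant under harmonic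
extension. -/
lemma sum_pairEnergy_harmChild (f : Fin 3 → ℝ) :
    ∑ j, pairEnergy (harmChild f j) = 3 / 5 * pairEnergy f := by
  simp [pairEnergy, harmChild, Fin.sum_univ_three]
  ring

lemma abs_harmChild_sub_le {f : Fin 3 → ℝ} {c : ℝ} (hf : ∀ a b, |f a - f b| ≤ c) (j a b : Fin 3) :
    |harmChild f j a - harmChild f j b| ≤ 3 / 5 * c := by
  have h01 := abs_le.1 (hf 0 1)
  have h02 := abs_le.1 (hf 0 2)
  have h12 := abs_le.1 (hf 1 2)
  rw [abs_le]
  fin_cases j <;> fin_cases a <;> fin_cases b <;> simp [harmChild, Fin.sum_univ_three] <;>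
    (try constructor) <;> linarith

/-- The value at the first vertex of the `m`-th triangle along an address. -/
def harmIter : ℕ → (Fin 3 → ℝ) → (ℕ → Fin 3) → ℝ
  | 0, f, _ => f 0
  | m + 1, f, ω => harmIter m (harmChild f (ω 0)) (tailAddr ω)

lemma dist_harmIter_succ_le (m : ℕ) {f : Fin 3 → ℝ} {c : ℝ} (hf : ∀ a b, |f a - f b| ≤ c)
    (ω : ℕ → Fin 3) : dist (harmIter m f ω) (harmIter (m + 1) f ω) ≤ c * (3 / 5) ^ m := by
  induction m generalizing f c ω with
  | zero =>
    have h1 := abs_harmChild_sub_le hf (ω 0) 0 (ω 0)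
    rw [harmChild_self] at h1
    have h2 := hf 0 (ω 0)
    have h01 := abs_le.1 (hf 0 1)
    have h02 := abs_le.1 (hf 0 2)
    rw [Real.dist_eq, pow_zero, mul_one]
    simp only [harmIter]
    generalize ω 0 = j
    rw [abs_le]
    fin_cases j <;> simp [harmChild, Fin.sum_univ_three] <;> (try constructor) <;> linarith
  | succ m ih =>
    refine (ih (abs_harmChild_sub_le hf (ω 0)) (tailAddr ω)).trans (le_of_eq ?_)
    ring

/-- The value of the harmonic function with vertex values `f` at the point with a given address. -/
def harmAddr (f : Fin 3 → ℝ) (ω : ℕ → Fin 3) : ℝ := limUnder atTop fun m => harmIter m f ω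

lemma exists_abs_sub_le (f : Fin 3 → ℝ) : ∃ c, ∀ a b, |f a - f b| ≤ c :=
  ⟨Real.sqrt (pairEnergy f), fun a b => Real.abs_le_sqrt (sq_sub_le_pairEnergy f a b)⟩

lemma tendsto_harmIter (f : Fin 3 → ℝ) (ω : ℕ → Fin 3) :
    Tendsto (fun m => harmIter m f ω) atTop (𝓝 (harmAddr f ω)) := by
  obtain ⟨c, hc⟩ := exists_abs_sub_le f
  exact (cauchySeq_of_le_geometric _ c (by norm_num : (3 / 5 : ℝ) < 1)
    fun m => dist_harmIter_succ_le m hc ω).tendsto_limUnder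

lemma harmAddr_eq (f : Fin 3 → ℝ) (ω : ℕ → Fin 3) :
    harmAddr f ω = harmAddr (harmChild f (ω 0)) (tailAddr ω) :=
  tendsto_nhds_unique ((tendsto_add_atTop_iff_nat 1).2 (tendsto_harmIter f ω))
    (tendsto_harmIter (harmChild f (ω 0)) (tailAddr ω))

lemma abs_harmAddr_sub_le {f : Fin 3 → ℝ} {c : ℝ} (hf : ∀ a b, |f a - f b| ≤ c) (ω : ℕ → Fin 3)
    (a : Fin 3) : |harmAddr f ω - f a| ≤ 4 * c := by
  have h := dist_le_of_le_geometric_of_tendsto₀ (3 / 5) c (by norm_num)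
    (fun m => dist_harmIter_succ_le m hf ω) (tendsto_harmIter f ω)
  rw [Real.dist_eq, harmIter, show c / (1 - 3 / 5) = 5 / 2 * c by ring] at h
  have h2 := hf 0 a
  have h3 := (abs_nonneg _).trans h2
  rw [abs_le] at *
  constructor <;> linarith [h.1, h.2, h2.1, h2.2]

lemma continuous_harmIter (m : ℕ) (f : Fin 3 → ℝ) : Continuous (harmIter m f) := by
  induction m generalizing f with
  | zero => exact continuous_const
  | succ m ih =>
    have h0 : Continuous fun ω : ℕ → Fin 3 => ω 0 := continuous_apply 0
    have ht : Continuous tailAddr := continuous_pi fun n => continuous_apply (n + 1)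
    have hF : Continuous fun p : Fin 3 × (ℕ → Fin 3) => harmIter m (harmChild f p.1) p.2 :=
      continuous_prod_of_discrete_left.2 fun j => ih (harmChild f j)
    exact hF.comp (h0.prodMk ht)

lemma continuous_harmAddr (f : Fin 3 → ℝ) : Continuous (harmAddr f) := by
  obtain ⟨c, hc⟩ := exists_abs_sub_le f
  have hu : TendstoUniformly (fun m => harmIter m f) (harmAddr f) atTop := by
    rw [Metric.tendstoUniformly_iff]
    intro ε hε
    have hlim : Tendsto (fun m : ℕ => c * (3 / 5 : ℝ) ^ m / (1 - 3 / 5)) atTop (𝓝 0) := by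
      have := ((tendsto_pow_atTop_nhds_zero_of_lt_one (by norm_num : (0 : ℝ) ≤ 3 / 5)
        (by norm_num)).const_mul c).div_const (1 - 3 / 5)
      simpa using this
    filter_upwards [hlim.eventually_lt_const hε] with m hm ω
    rw [dist_comm]
    exact (dist_le_of_le_geometric_of_tendsto (3 / 5) c (by norm_num)
      (fun m => dist_harmIter_succ_le m hc ω) (tendsto_harmIter f ω) m).trans_lt hm
  exact hu.continuous (Frequently.of_forall fun m => continuous_harmIter m f)

lemma eq_vertex_of_contraction_eq {j k : Fin 3} (hjk : j ≠ k) {x y : Plane}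
    (hx : x ∈ compactGasket) (hy : y ∈ compactGasket) (h : contraction j x = contraction k y) :
    x = vertex k := by
  have h1 := congrArg (bary k) h
  rw [bary_contraction, bary_contraction, if_pos rfl, if_neg (Ne.symm hjk)] at h1
  have h2 := bary_nonneg hy k
  have h3 := bary_le_one hx k
  exact eq_vertex_of_bary (bary_nonneg hx) (by linarith)

lemma eq_zero_of_forall_le_geometric {x c : ℝ} (h : ∀ m : ℕ, |x| ≤ c * (3 / 5) ^ m) : x = 0 := by
  have hlim : Tendsto (fun m : ℕ => c * (3 / 5 : ℝ) ^ m) atTop (𝓝 0) := by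
    simpa using (tendsto_pow_atTop_nhds_zero_of_lt_one (by norm_num : (0 : ℝ) ≤ 3 / 5)
      (by norm_num)).const_mul c
  exact abs_nonpos_iff.1 (ge_of_tendsto hlim (Eventually.of_forall h))

/-- An address of `vertex k` must have first digit `k` and a tail of the same kind, so it stays in
subtriangles whose value at that corner is `f k` while the oscillation shrinks by 3/5 per digit. -/
lemma harmAddr_of_coding_eq_vertex (f : Fin 3 → ℝ) {ω : ℕ → Fin 3} {k : Fin 3}
    (h : coding ω = vertex k) : harmAddr f ω = f k := by
  have key : ∀ (m : ℕ) (f : Fin 3 → ℝ) (c : ℝ) (ω : ℕ → Fin 3), (∀ a b, |f a - f b| ≤ c) →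
      coding ω = vertex k → |harmAddr f ω - f k| ≤ 4 * c * (3 / 5) ^ m := by
    intro m
    induction m with
    | zero => intro f c ω hf _; simpa using abs_harmAddr_sub_le hf ω k
    | succ m ih =>
      intro f c ω hf hω
      have h0 : ω 0 = k ∧ coding (tailAddr ω) = vertex k := by
        rw [coding_eq, ← contraction_vertex_self k] at hω
        by_cases hk : ω 0 = k
        · rw [hk] at hω; exact ⟨hk, contraction_injective k hω⟩
        · exfalso
          have h1 := eq_vertex_of_contraction_eq (Ne.symm hk) (vertex_mem k)
            (coding_mem (tailAddr ω)) hω.symm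
          have := dist_vertex hk
          rw [h1, dist_self] at this
          exact zero_ne_one this
      have := ih _ _ _ (abs_harmChild_sub_le hf k) h0.2
      rw [harmChild_self] at this
      rw [harmAddr_eq, h0.1]
      refine this.trans (le_of_eq ?_)
      ring
  obtain ⟨c, hc⟩ := exists_abs_sub_le f
  exact sub_eq_zero.1 (eq_zero_of_forall_le_geometric fun m => key m f c ω hc h)

/-- Equal first digits are stripped, gaining a factor 3/5. At a first disagreement the point is the
common corner of two subtriangles, where both rules give the same midpoint value (`harmChild_comm`).
-/
lemma harmAddr_eq_of_coding_eq (f : Fin 3 → ℝ) {ω ω' : ℕ → Fin 3} (h : coding ω = coding ω') :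
    harmAddr f ω = harmAddr f ω' := by
  have key : ∀ (m : ℕ) (f : Fin 3 → ℝ) (c : ℝ) (ω ω' : ℕ → Fin 3), (∀ a b, |f a - f b| ≤ c) →
      coding ω = coding ω' → |harmAddr f ω - harmAddr f ω'| ≤ 8 * c * (3 / 5) ^ m := by
    intro m
    induction m with
    | zero =>
      intro f c ω ω' hf _
      have h1 := abs_harmAddr_sub_le hf ω 0
      have h2 := abs_harmAddr_sub_le hf ω' 0
      rw [pow_zero, mul_one]
      rw [abs_le] at *
      constructor <;> linarith [h1.1, h1.2, h2.1, h2.2]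
    | succ m ih =>
      intro f c ω ω' hf hω
      rw [coding_eq ω, coding_eq ω'] at hω
      by_cases h0 : ω 0 = ω' 0
      · rw [← h0] at hω
        have := ih _ _ _ _ (abs_harmChild_sub_le hf (ω 0)) (contraction_injective _ hω)
        rw [harmAddr_eq f ω, harmAddr_eq f ω', ← h0]
        refine this.trans (le_of_eq ?_)
        ring
      · have h1 := eq_vertex_of_contraction_eq h0 (coding_mem _) (coding_mem _) hω
        have h2 := eq_vertex_of_contraction_eq (Ne.symm h0) (coding_mem _) (coding_mem _) hω.symm
        rw [harmAddr_eq f ω, harmAddr_eq f ω', harmAddr_of_coding_eq_vertex _ h1,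
          harmAddr_of_coding_eq_vertex _ h2, harmChild_comm, sub_self, abs_zero]
        have := (abs_nonneg _).trans (hf 0 0)
        positivity
  obtain ⟨c, hc⟩ := exists_abs_sub_le f
  exact sub_eq_zero.1 (eq_zero_of_forall_le_geometric fun m => key m f c ω ω' hc h)

open scoped Classical in
/-- The harmonic function on the compact gasket with given vertex values. -/
def harm (f : Fin 3 → ℝ) (p : Plane) : ℝ :=
  if h : ∃ ω, coding ω = p then harmAddr f h.choose else 0

lemma harm_coding (f : Fin 3 → ℝ) (ω : ℕ → Fin 3) : harm f (coding ω) = harmAddr f ω := by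
  have h : ∃ ω', coding ω' = coding ω := ⟨ω, rfl⟩
  rw [harm, dif_pos h]
  exact harmAddr_eq_of_coding_eq f h.choose_spec

lemma harm_vertex (f : Fin 3 → ℝ) (a : Fin 3) : harm f (vertex a) = f a := by
  rw [← coding_const a, harm_coding, harmAddr_of_coding_eq_vertex f (coding_const a)]

lemma harm_contraction (f : Fin 3 → ℝ) (j : Fin 3) {x : Plane} (hx : x ∈ compactGasket) :
    harm f (contraction j x) = harm (harmChild f j) x := by
  rw [compactGasket_eq_range] at hx
  obtain ⟨ω, rfl⟩ := hx
  rw [← coding_cons, harm_coding, harm_coding, harmAddr_eq]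
  rfl

lemma abs_harm_sub_le {f : Fin 3 → ℝ} {c : ℝ} (hf : ∀ a b, |f a - f b| ≤ c) {x : Plane}
    (hx : x ∈ compactGasket) (a : Fin 3) : |harm f x - f a| ≤ 4 * c := by
  rw [compactGasket_eq_range] at hx
  obtain ⟨ω, rfl⟩ := hx
  rw [harm_coding]
  exact abs_harmAddr_sub_le hf ω a

/-- Continuity descends from addresses to points because `coding` maps compact sets to closed sets.
-/
lemma continuousOn_harm (f : Fin 3 → ℝ) : ContinuousOn (harm f) compactGasket := by
  rw [continuousOn_iff_isClosed]
  intro t ht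
  refine ⟨coding '' (harmAddr f ⁻¹' t),
    ((ht.preimage (continuous_harmAddr f)).isCompact.image continuous_coding).isClosed, ?_⟩
  rw [compactGasket_eq_range]
  ext p
  constructor
  · rintro ⟨hp, ω, rfl⟩
    rw [mem_preimage, harm_coding] at hp
    exact ⟨⟨ω, hp, rfl⟩, ω, rfl⟩
  · rintro ⟨⟨ω, hω, rfl⟩, _⟩
    refine ⟨?_, ω, rfl⟩
    rw [mem_preimage, harm_coding]
    exact hω

/-! ### Harmonic splines -/

/-- The function on the infinite gasket which is harmonic on every cell of side `2ⁿ` and coincides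
with `φ` at the vertices of these cells. -/
def spline (φ : Plane → ℝ) (n : ℤ) (z : infGasket) : ℝ :=
  harm (vertexValues φ (exists_eq_scaledCell n z).choose n)
    (exists_eq_scaledCell n z).choose_spec.choose

/-- The cell chosen in `spline` is immaterial: a point in two cells is a vertex of both, and there
the value is that of `φ`. -/
lemma spline_eq (φ : Plane → ℝ) {n : ℤ} {z : infGasket} {i : CellIndex} {x : Plane}
    (hx : x ∈ compactGasket) (h : scaledCell i n x = z) :
    spline φ n z = harm (vertexValues φ i n) x := by
  obtain ⟨hy, hyz⟩ := (exists_eq_scaledCell n z).choose_spec.choose_spec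
  unfold spline
  generalize (exists_eq_scaledCell n z).choose_spec.choose = y at hy hyz ⊢
  generalize (exists_eq_scaledCell n z).choose = i' at hyz ⊢
  have he := hyz.trans h.symm
  by_cases hi : i' = i
  · subst hi
    rw [scaledCell_injective _ _ he]
  · obtain ⟨a, rfl⟩ := exists_vertex_of_scaledCell_eq hy hx hi he
    obtain ⟨b, rfl⟩ := exists_vertex_of_scaledCell_eq hx hy (Ne.symm hi) he.symm
    rw [harm_vertex, harm_vertex, vertexValues, vertexValues, he]

lemma extendZero_spline (φ : Plane → ℝ) (n : ℤ) (i : CellIndex) {x : Plane}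
    (hx : x ∈ compactGasket) :
    extendZero (spline φ n) (scaledCell i n x) = harm (vertexValues φ i n) x := by
  rw [← spline_eq φ (z := ⟨_, scaledCell_mem hx⟩) hx rfl]
  exact extendZero_coe _ ⟨_, scaledCell_mem hx⟩

lemma continuous_spline (φ : Plane → ℝ) (n : ℤ) : Continuous (spline φ n) := by
  have hlf : LocallyFinite fun i => dyadicTriangle i n := by
    simp only [dyadicTriangle_eq]
    exact (locallyFinite_cell n).preimage_continuous continuous_subtype_val
  refine hlf.continuous ?_ (fun i => ?_) fun i => ?_
  · refine eq_univ_of_forall fun z => ?_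
    obtain ⟨i, x, hx, h⟩ := exists_eq_scaledCell n z
    exact mem_iUnion.2 ⟨i, by rw [dyadicTriangle_eq]; exact ⟨x, hx, h⟩⟩
  · rw [dyadicTriangle_eq]
    exact (isCompact_cell i n).isClosed.preimage continuous_subtype_val
  · let g : infGasket → Plane := fun z =>
      ((2 : ℝ) ^ n * ((i.1 : ℤ) : ℝ))⁻¹ • (z : Plane) - offset i.2
    have hg : ∀ z x, scaledCell i n x = (z : infGasket) → g z = x := by
      intro z x h
      simp only [g]
      rw [← h, scaledCell_eq, smul_smul, inv_mul_cancel₀ (scale_ne_zero i n), one_smul,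
        add_sub_cancel_right]
    have hgc : Continuous g := by fun_prop
    have hmaps : MapsTo g (dyadicTriangle i n) compactGasket := by
      intro z hz
      rw [dyadicTriangle_eq] at hz
      obtain ⟨x, hx, h⟩ := hz
      rw [hg z x h]; exact hx
    refine ((continuousOn_harm (vertexValues φ i n)).comp hgc.continuousOn hmaps).congr ?_
    intro z hz
    rw [dyadicTriangle_eq] at hz
    obtain ⟨x, hx, h⟩ := hz
    rw [Function.comp_apply, hg z x h]
    exact spline_eq φ hx h

lemma subEnergy_of_eq_harm {U : Plane → ℝ} (k : ℕ) : ∀ {i : CellIndex} {n : ℤ} {f : Fin 3 → ℝ},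
    (∀ x ∈ compactGasket, U (scaledCell i n x) = harm f x) →
    subEnergy U k i n = ENNReal.ofReal ((5 / 3) ^ (-n) * pairEnergy f) := by
  induction k with
  | zero =>
    intro i n f h
    rw [subEnergy, cellEnergy]
    congr 3
    exact funext fun a => (h _ (vertex_mem a)).trans (harm_vertex f a)
  | succ k ih =>
    intro i n f h
    have hj : ∀ j, subEnergy U k (child i j) (n - 1) =
        ENNReal.ofReal ((5 / 3) ^ (-(n - 1)) * pairEnergy (harmChild f j)) := fun j =>
      ih fun x hx => by
        rw [← scaledCell_contraction, h _ (contraction_mem hx), harm_contraction f j hx]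
    simp only [subEnergy, hj]
    rw [← ENNReal.ofReal_sum_of_nonneg fun j _ => mul_nonneg (by positivity) (pairEnergy_nonneg _),
      ← Finset.mul_sum, sum_pairEnergy_harmChild, neg_sub, sub_eq_neg_add, zpow_add_one₀
      (by norm_num)]
    congr 1
    ring

lemma energy_spline_le (φ : Plane → ℝ) (n : ℤ) : energy (spline φ n) ≤ ∑' i, cellEnergy φ i n := by
  refine iSup_le fun m => (energyApprox_le_tsum _ m).trans ?_
  -- Refine to a scale below both `n` and `-m`; below `n` the energy of the spline no longer
  -- changes.
  have hk : n - ((n + m).toNat : ℤ) ≤ -(m : ℤ) := by omega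
  refine (tsum_cellEnergy_antitone (extendZero (spline φ n)) hk).trans ?_
  simp only
  rw [← tsum_subEnergy]
  refine ENNReal.tsum_le_tsum fun i => le_of_eq ?_
  rw [subEnergy_of_eq_harm _ fun x hx => extendZero_spline φ n i hx, cellEnergy]

/-! ### Test functions -/

/-- The indices of the cells having a vertex in common with a given cell. -/
def neighbours (i₀ : CellIndex) (n : ℤ) : Set CellIndex :=
  {i | ∃ a c, scaledCell i n (vertex a) = scaledCell i₀ n (vertex c)}

/-- A neighbour is determined by its sign, the label of its shared vertex and the label of that
vertex in `i₀`, hence 2·3·3 = 18. -/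
lemma exists_finset_neighbours (i₀ : CellIndex) (n : ℤ) :
    ∃ s : Finset CellIndex, (s : Set CellIndex) = neighbours i₀ n ∧ s.card ≤ 18 := by
  have hex : ∀ i : neighbours i₀ n, ∃ a c,
      scaledCell i.1 n (vertex a) = scaledCell i₀ n (vertex c) := fun i => i.2
  choose a c h using hex
  let g : neighbours i₀ n → Fin 3 × Fin 3 × ℤˣ := fun i => (a i, c i, i.1.1)
  have hg : Function.Injective g := by
    intro i i' hii
    simp only [g, Prod.mk.injEq] at hii
    refine Subtype.ext (eq_of_scaledCell_vertex_eq hii.2.2 (n := n) (x := vertex (a i)) ?_)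
    rw [h i, hii.1, h i', hii.2.1]
  have hfin : Finite (neighbours i₀ n) := Finite.of_injective g hg
  have hfin' : (neighbours i₀ n).Finite := hfin
  refine ⟨hfin'.toFinset, hfin'.coe_toFinset, ?_⟩
  rw [← Set.ncard_eq_toFinset_card _ hfin', ← Nat.card_coe_set_eq]
  refine (Nat.card_le_card_of_injective g hg).trans (le_of_eq ?_)
  simp [Nat.card_eq_fintype_card]

open scoped Classical in
/-- The indicator function of the vertices of a cell. -/
def vertexIndicator (i₀ : CellIndex) (n : ℤ) (p : Plane) : ℝ :=
  if ∃ c, p = scaledCell i₀ n (vertex c) then 1 else 0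

lemma vertexIndicator_mem (i₀ : CellIndex) (n : ℤ) (p : Plane) :
    vertexIndicator i₀ n p ∈ Icc (0 : ℝ) 1 := by
  unfold vertexIndicator
  split_ifs <;> simp

lemma abs_vertexIndicator_sub_le (i₀ : CellIndex) (n : ℤ) (p q : Plane) :
    |vertexIndicator i₀ n p - vertexIndicator i₀ n q| ≤ 1 := by
  have h1 := vertexIndicator_mem i₀ n p
  have h2 := vertexIndicator_mem i₀ n q
  rw [abs_le]
  constructor <;> linarith [h1.1, h1.2, h2.1, h2.2]

lemma vertexValues_vertexIndicator_of_notMem {i i₀ : CellIndex} {n : ℤ}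
    (h : i ∉ neighbours i₀ n) (a : Fin 3) : vertexValues (vertexIndicator i₀ n) i n a = 0 := by
  rw [vertexValues, vertexIndicator, if_neg]
  rintro ⟨c, hc⟩
  exact h ⟨a, c, hc⟩

lemma harm_eq_of_forall_eq {f : Fin 3 → ℝ} {c : ℝ} (hf : ∀ a, f a = c) {x : Plane}
    (hx : x ∈ compactGasket) : harm f x = c := by
  have h := abs_harm_sub_le (f := f) (c := 0) (fun a b => by simp [hf]) hx 0
  rw [mul_zero, hf] at h
  exact sub_eq_zero.1 (abs_nonpos_iff.1 h)

/-- The spline of the vertex indicator. Each of the 18 cells contributes at most 9 ordered pairs,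
whence 162. The bound 5 = 1 + 4 on `|u|` comes from `abs_harm_sub_le`; the sharp maximum principle
is not needed. -/
lemma exists_test_function (i₀ : CellIndex) (n : ℤ) : ∃ u ∈ formDomain,
    (∀ z ∈ dyadicTriangle i₀ n, u z = 1) ∧
    energy u ≤ 162 * ENNReal.ofReal ((5 / 3) ^ (-n)) ∧
    ∀ p : ℝ≥0∞, eLpNorm u p nuHat ≤ 5 * (18 * 3 ^ n) ^ p⁻¹.toReal := by
  obtain ⟨s, hs, hcard⟩ := exists_finset_neighbours i₀ n
  have hs' : ∀ i, i ∉ s → i ∉ neighbours i₀ n := fun i hi => by rw [← hs]; exact hi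
  set φ := vertexIndicator i₀ n with hφ
  have hosc : ∀ i a b, |vertexValues φ i n a - vertexValues φ i n b| ≤ 1 := fun i a b =>
    abs_vertexIndicator_sub_le i₀ n _ _
  have hE : energy (spline φ n) ≤ 162 * ENNReal.ofReal ((5 / 3) ^ (-n)) := by
    refine (energy_spline_le φ n).trans ?_
    rw [tsum_eq_sum (s := s)]
    · have hle : ∀ i ∈ s, cellEnergy φ i n ≤ 9 * ENNReal.ofReal ((5 / 3) ^ (-n)) := by
        intro i _
        rw [cellEnergy, mul_comm 9, show (9 : ℝ≥0∞) = ENNReal.ofReal 9 by simp,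
          ← ENNReal.ofReal_mul (by positivity)]
        refine ENNReal.ofReal_le_ofReal (mul_le_mul_of_nonneg_left ?_ (by positivity))
        have : ∀ a b, (vertexValues φ i n a - vertexValues φ i n b) ^ 2 ≤ 1 := fun a b =>
          (sq_le_one_iff_abs_le_one _).2 (hosc i a b)
        calc pairEnergy (vertexValues φ i n) ≤ ∑ _a : Fin 3, ∑ _b : Fin 3, (1 : ℝ) :=
              Finset.sum_le_sum fun a _ => Finset.sum_le_sum fun b _ => this a b
          _ = 9 := by norm_num
      refine (Finset.sum_le_card_nsmul s _ _ hle).trans ?_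
      rw [nsmul_eq_mul, ← mul_assoc]
      refine mul_le_mul_left ?_ _
      calc (s.card : ℝ≥0∞) * 9 ≤ (18 : ℕ) * 9 := mul_le_mul_left (by exact_mod_cast hcard) _
        _ = 162 := by norm_num
    · intro i hi
      have h0 := vertexValues_vertexIndicator_of_notMem (hs' i hi)
      simp [cellEnergy, pairEnergy, hφ, h0]
  have hbound : ∀ z, ‖spline φ n z‖ₑ ≤
      ‖(⋃ i ∈ s, dyadicTriangle i n).indicator (fun _ => (5 : ℝ)) z‖ₑ := by
    intro z
    obtain ⟨i, x, hx, h⟩ := exists_eq_scaledCell n z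
    rw [spline_eq φ hx h]
    by_cases hi : i ∈ s
    · have hz : z ∈ ⋃ i ∈ s, dyadicTriangle i n := by
        refine mem_iUnion₂.2 ⟨i, hi, ?_⟩
        rw [dyadicTriangle_eq]; exact ⟨x, hx, h⟩
      rw [indicator_of_mem hz, Real.enorm_eq_ofReal_abs, Real.enorm_eq_ofReal_abs]
      refine ENNReal.ofReal_le_ofReal ?_
      have h1 := abs_harm_sub_le (hosc i) hx 0
      have h2 : vertexValues φ i n 0 ∈ Icc (0 : ℝ) 1 := vertexIndicator_mem i₀ n _
      rw [abs_of_pos (by norm_num : (0 : ℝ) < 5)]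
      rw [abs_le] at *
      constructor <;> linarith [h1.1, h1.2, h2.1, h2.2]
    · rw [harm_eq_of_forall_eq (vertexValues_vertexIndicator_of_notMem (hs' i hi)) hx]
      simp
  have hnorm : ∀ p : ℝ≥0∞, eLpNorm (spline φ n) p nuHat ≤ 5 * (18 * 3 ^ n) ^ p⁻¹.toReal := by
    intro p
    refine (eLpNorm_mono_enorm hbound).trans ((eLpNorm_indicator_const_le _ _).trans ?_)
    rw [one_div, ← ENNReal.toReal_inv, Real.enorm_eq_ofReal (by norm_num)]
    refine mul_le_mul' (by simp) (ENNReal.rpow_le_rpow ?_ ENNReal.toReal_nonneg)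
    refine (measure_biUnion_finset_le s _).trans ?_
    simp only [nuHat_dyadicTriangle, Finset.sum_const, nsmul_eq_mul]
    exact mul_le_mul_left (by exact_mod_cast hcard) _
  refine ⟨⟨spline φ n, continuous_spline φ n⟩, ⟨?_, ?_, ?_⟩, ?_, hE, hnorm⟩
  · exact hE.trans_lt (ENNReal.mul_lt_top (by norm_num) ENNReal.ofReal_lt_top)
  · exact (continuous_spline φ n).aestronglyMeasurable
  · refine (hnorm 2).trans_lt (ENNReal.mul_lt_top (by norm_num) ?_)
    exact ENNReal.rpow_lt_top_of_nonneg ENNReal.toReal_nonneg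
      (ENNReal.mul_ne_top (by norm_num) (three_zpow_ne_top n))
  · intro z hz
    rw [dyadicTriangle_eq] at hz
    obtain ⟨x, hx, h⟩ := hz
    refine (spline_eq φ hx h).trans (harm_eq_of_forall_eq (fun a => ?_) hx)
    rw [vertexValues, hφ, vertexIndicator, if_pos ⟨a, rfl⟩]

/-! ### Necessary conditions on the exponents, by testing. -/

/-! ### Optimality of the exponents -/

lemma rpow_le_self_of_one_le {x : ℝ≥0∞} (hx : 1 ≤ x) {t : ℝ} (ht : t ≤ 1) : x ^ t ≤ x := by
  conv_rhs => rw [← ENNReal.rpow_one x]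
  exact ENNReal.rpow_le_rpow_of_exponent_le hx ht

lemma measurableSet_dyadicTriangle (i : CellIndex) (n : ℤ) : MeasurableSet (dyadicTriangle i n) := by
  rw [dyadicTriangle_eq]; exact measurable_subtype_coe (measurableSet_cell i n)

/-- The test function dominates the indicator of the cell, which bounds the left-hand side from
below. The constant is 162·90, with 90 = 5·18. -/
lemma SobolevInequality.measure_rpow_le {σ : Measure infGasket} {p q : ℝ≥0∞} {C : ℝ≥0} {N : ℕ}
    {b : Fin N → ℝ} (h : SobolevInequality σ p q C b) (hp : 1 ≤ p) (hq : q ≠ 0)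
    (hb : ∀ i, b i ∈ Icc (0 : ℝ) 1) {i₀ : CellIndex} {n : ℤ} (hσ : σ (dyadicTriangle i₀ n) ≠ 0) :
    σ (dyadicTriangle i₀ n) ^ q⁻¹.toReal ≤ C * (14580 * ∑ i,
      3 ^ (n * (p⁻¹.toReal - b i * (p⁻¹.toReal + 1 / (2 * deltaS))))) := by
  obtain ⟨u, hu, hu1, hE, hL⟩ := exists_test_function i₀ n
  have hs1 : p⁻¹.toReal ≤ 1 := by
    simpa using ENNReal.toReal_mono ENNReal.one_ne_top (ENNReal.inv_le_one.2 hp)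
  have hs0 : 0 ≤ p⁻¹.toReal := ENNReal.toReal_nonneg
  have hlow : σ (dyadicTriangle i₀ n) ^ q⁻¹.toReal ≤ eLpNorm u q σ := by
    have h1 := eLpNorm_indicator_const' (c := (1 : ℝ)) (measurableSet_dyadicTriangle i₀ n) hσ hq
    rw [enorm_one, one_mul, one_div, ← ENNReal.toReal_inv] at h1
    rw [← h1]
    refine eLpNorm_mono_enorm fun z => ?_
    by_cases hz : z ∈ dyadicTriangle i₀ n
    · rw [indicator_of_mem hz, hu1 z hz]
    · rw [indicator_of_notMem hz, enorm_zero]; exact zero_le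
  refine hlow.trans ((h u hu).trans (mul_le_mul_right ?_ _))
  rw [Finset.mul_sum]
  refine Finset.sum_le_sum fun i _ => ?_
  obtain ⟨hb0, hb1⟩ := hb i
  have hA : energy u ^ (b i / 2) ≤ 162 * 3 ^ (-(n * (1 / (2 * deltaS)) * b i)) := by
    refine (ENNReal.rpow_le_rpow hE (by positivity)).trans ?_
    rw [ENNReal.mul_rpow_of_nonneg _ _ (by positivity), ofReal_five_thirds_zpow, ← ENNReal.rpow_mul]
    refine mul_le_mul' (rpow_le_self_of_one_le (by norm_num) (by linarith)) (le_of_eq ?_)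
    congr 1; push_cast; ring
  have hB : eLpNorm u p nuHat ^ (1 - b i) ≤ 90 * 3 ^ (n * p⁻¹.toReal * (1 - b i)) := by
    have hb' : 0 ≤ 1 - b i := by linarith
    refine (ENNReal.rpow_le_rpow (hL p) hb').trans ?_
    rw [ENNReal.mul_rpow_of_nonneg _ _ hs0, three_zpow_rpow, ← mul_assoc,
      ENNReal.mul_rpow_of_nonneg _ _ hb', ← ENNReal.rpow_mul]
    refine mul_le_mul_left ?_ _
    have h18 : (18 : ℝ≥0∞) ^ p⁻¹.toReal ≤ 18 := rpow_le_self_of_one_le (by norm_num) hs1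
    calc (5 * (18 : ℝ≥0∞) ^ p⁻¹.toReal) ^ (1 - b i) ≤ (5 * 18) ^ (1 - b i) :=
          ENNReal.rpow_le_rpow (mul_le_mul_right h18 _) hb'
      _ ≤ 5 * 18 := rpow_le_self_of_one_le (by norm_num) (by linarith)
      _ = 90 := by norm_num
  refine (mul_le_mul' hA hB).trans (le_of_eq ?_)
  rw [mul_mul_mul_comm, ← three_rpow_add]
  congr 1
  · norm_num
  · congr 1; ring

/-- The dominant summand has the smallest `b i` for large cells and the largest for small ones; the
sign of `n` in the condition on `β` covers both cases. -/
lemma measure_rpow_le_of_forall_le {σ : Measure infGasket} {p q : ℝ≥0∞} {C : ℝ≥0} {N : ℕ}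
    {b : Fin N → ℝ} (h : SobolevInequality σ p q C b) (hp : 1 ≤ p) (hq : q ≠ 0)
    (hb : ∀ i, b i ∈ Icc (0 : ℝ) 1) {i₀ : CellIndex} {n : ℤ} (hσ : σ (dyadicTriangle i₀ n) ≠ 0)
    {β : ℝ} (hβ : ∀ i, (n : ℝ) * β ≤ n * b i) :
    σ (dyadicTriangle i₀ n) ^ q⁻¹.toReal ≤ ENNReal.ofReal ((C * 14580 * N) *
      3 ^ (n * (p⁻¹.toReal - β * (p⁻¹.toReal + 1 / (2 * deltaS))))) := by
  refine (h.measure_rpow_le hp hq hb hσ).trans ?_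
  have hsθ : 0 ≤ p⁻¹.toReal + 1 / (2 * deltaS) :=
    add_nonneg ENNReal.toReal_nonneg one_div_two_mul_deltaS_pos.le
  have hsum : ∑ i, (3 : ℝ≥0∞) ^ (n * (p⁻¹.toReal - b i * (p⁻¹.toReal + 1 / (2 * deltaS)))) ≤
      N * 3 ^ (n * (p⁻¹.toReal - β * (p⁻¹.toReal + 1 / (2 * deltaS)))) := by
    refine (Finset.sum_le_card_nsmul _ _
      (3 ^ (n * (p⁻¹.toReal - β * (p⁻¹.toReal + 1 / (2 * deltaS))))) fun i _ => ?_).trans (le_of_eq ?_)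
    · exact ENNReal.rpow_le_rpow_of_exponent_le (by norm_num)
        (by nlinarith [mul_le_mul_of_nonneg_right (hβ i) hsθ])
    · rw [Finset.card_univ, Fintype.card_fin, nsmul_eq_mul]
  refine (mul_le_mul_right (mul_le_mul_right hsum _) _).trans (le_of_eq ?_)
  rw [ENNReal.ofReal_mul (by positivity), ENNReal.ofReal_mul (by positivity),
    ENNReal.ofReal_mul (by positivity), ofReal_three_rpow, ENNReal.ofReal_coe_nnreal,
    ENNReal.ofReal_natCast]
  norm_num
  ring

lemma eventually_ratio_eq {l : Filter ℤ} {σ : Measure infGasket} {δ : ℝ≥0∞} (hδ : δ ≠ 0)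
    {i : ℤ → CellIndex} {k : ℤ → ℤ} (hk : ∀ᶠ m in l, k m ≠ 0)
    (hfin : ∀ m, σ (dyadicTriangle (i m) (k m)) ≠ ∞)
    (h : Tendsto (fun m => ENNReal.log (σ (dyadicTriangle (i m) (k m))) /
      ENNReal.log (nuHat (dyadicTriangle (i m) (k m)))) l (𝓝 ((δ⁻¹ : ℝ≥0∞) : EReal))) :
    (∀ᶠ m in l, σ (dyadicTriangle (i m) (k m)) ≠ 0) ∧
    Tendsto (fun m => Real.log (σ (dyadicTriangle (i m) (k m))).toReal / (k m * Real.log 3)) l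
      (𝓝 δ⁻¹.toReal) := by
  have h3 : 0 < Real.log 3 := Real.log_pos (by norm_num)
  have hν : ∀ m, ENNReal.log (nuHat (dyadicTriangle (i m) (k m))) =
      ((k m * Real.log 3 : ℝ) : EReal) := by
    intro m
    have : (3 : ℝ≥0∞) ^ (k m) = ENNReal.ofReal (3 ^ (k m)) := by
      rw [← Real.rpow_intCast, ofReal_three_rpow, ENNReal.rpow_intCast]
    rw [nuHat_dyadicTriangle, this, ENNReal.log_ofReal_of_pos (by positivity), Real.log_zpow]
  simp only [hν] at h
  have hδtop : δ⁻¹ ≠ ∞ := ENNReal.inv_ne_top.2 hδ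
  have ht1 : ((δ⁻¹ : ℝ≥0∞) : EReal) ≠ ⊤ := by simpa using hδ
  have ht2 : ((δ⁻¹ : ℝ≥0∞) : EReal) ≠ ⊥ := EReal.coe_ennreal_ne_bot _
  -- A null triangle with `k m ≠ 0` would make the extended ratio infinite, whereas the limit is
  -- finite.
  have hne : ∀ᶠ m in l, σ (dyadicTriangle (i m) (k m)) ≠ 0 := by
    filter_upwards [h.eventually_ne ht1, h.eventually_ne ht2, hk] with m hm1 hm2 hkm h0
    rw [h0, ENNReal.log_zero] at hm1 hm2
    have hkm' : ((k m : ℝ)) ≠ 0 := by exact_mod_cast hkm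
    rcases lt_or_gt_of_ne (mul_ne_zero hkm' h3.ne') with hlt | hgt
    · refine hm1 (EReal.bot_div_of_neg_ne_bot ?_ (EReal.coe_ne_bot _))
      exact_mod_cast hlt
    · refine hm2 (EReal.bot_div_of_pos_ne_top ?_ (EReal.coe_ne_top _))
      exact_mod_cast hgt
  refine ⟨hne, ?_⟩
  have hr := (EReal.tendsto_toReal ht1 ht2).comp h
  rw [EReal.toReal_coe_ennreal] at hr
  refine hr.congr' ?_
  filter_upwards [hne] with m hm
  have hpos := ENNReal.toReal_pos hm (hfin m)
  rw [Function.comp_apply, ← ENNReal.ofReal_toReal (hfin m), ENNReal.log_ofReal_of_pos hpos,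
    ← EReal.coe_div, EReal.toReal_coe, ENNReal.ofReal_toReal (hfin m)]

lemma log_le_of_rpow_le {x : ℝ≥0∞} (hx : x ≠ 0) (hx' : x ≠ ∞) {t c e : ℝ} (hc : 0 < c) {n : ℤ}
    (h : x ^ t ≤ ENNReal.ofReal (c * 3 ^ (n * e))) :
    t * Real.log x.toReal ≤ Real.log c + n * e * Real.log 3 := by
  have hpos := ENNReal.toReal_pos hx hx'
  have h1 : x.toReal ^ t ≤ c * 3 ^ (n * e) := by
    rw [ENNReal.toReal_rpow]
    exact ENNReal.toReal_le_of_le_ofReal (by positivity) h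
  have h2 := Real.log_le_log (Real.rpow_pos_of_pos hpos t) h1
  rwa [Real.log_rpow hpos, Real.log_mul hc.ne' (by positivity), Real.log_rpow (by norm_num)] at h2

lemma DyadicUpperRegular.ne_top {σ : Measure infGasket} {K : ℝ≥0} {δlo δup : ℝ≥0∞}
    (h : DyadicUpperRegular σ K δlo δup) (i : CellIndex) (n : ℤ) :
    σ (dyadicTriangle i n) ≠ ∞ := by
  rcases lt_or_ge n 0 with hn | hn
  · refine ne_top_of_le_ne_top ?_ (h.le_of_neg hn i)
    rw [three_zpow_rpow]
    exact ENNReal.mul_ne_top ENNReal.coe_ne_top (three_rpow_ne_top _)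
  · refine ne_top_of_le_ne_top ?_ (h.le_of_nonneg hn i)
    rw [three_zpow_rpow]
    exact ENNReal.mul_ne_top ENNReal.coe_ne_top (three_rpow_ne_top _)

lemma intCast_eq_log_diam (i : CellIndex) (n : ℤ) :
    (n : ℝ) = Real.log (Metric.diam (dyadicTriangle i n)) / Real.log 2 := by
  have h2 : Real.log 2 ≠ 0 := (Real.log_pos (by norm_num)).ne'
  rw [diam_dyadicTriangle, Real.log_zpow]
  field_simp

theorem SobolevInequality.exponents_optimal {σ : Measure infGasket} {p q δlo δup : ℝ≥0∞}
    {K C : ℝ≥0} {N : ℕ} {b : Fin N → ℝ} (hp : 1 ≤ p) (hq : 2 ≤ q) (hlo : 0 < δlo)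
    (hlu : δlo ≤ δup) (hσ : DyadicUpperRegular σ K δlo δup)
    (hatt : ExponentsAttained σ δlo δup) (hN : 0 < N) (hb : ∀ i, b i ∈ Icc (0 : ℝ) 1) (hC : 0 < C)
    (h : SobolevInequality σ p q C b) :
    ⨅ i, b i ≤ sobolevExponent p q δlo ∧ sobolevExponent p q δup ≤ ⨆ i, b i := by
  obtain ⟨T, hT, hbot, htop, hrbot, hrtop⟩ := hatt
  choose i k hik using hT
  obtain rfl : T = fun m => dyadicTriangle (i m) (k m) := funext hik
  have hq0 : q ≠ 0 := (two_pos.trans_le hq).ne'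
  have hup0 : δup ≠ 0 := (hlo.trans_le hlu).ne'
  have h3 : 0 < Real.log 3 := Real.log_pos (by norm_num)
  have h2 : 0 < Real.log 2 := Real.log_pos (by norm_num)
  have hsθ : 0 < p⁻¹.toReal + 1 / (2 * deltaS) :=
    add_pos_of_nonneg_of_pos ENNReal.toReal_nonneg one_div_two_mul_deltaS_pos
  have hc : (0 : ℝ) < C * 14580 * N := by
    have : (0 : ℝ) < C := by exact_mod_cast hC
    have : (0 : ℝ) < N := by exact_mod_cast hN
    positivity
  have hkbot : Tendsto (fun m => (k m : ℝ)) atBot atBot := by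
    have hw : Tendsto (fun m => Metric.diam (dyadicTriangle (i m) (k m))) atBot (𝓝[>] 0) :=
      tendsto_nhdsWithin_iff.2 ⟨hbot, Eventually.of_forall fun m => by
        rw [diam_dyadicTriangle, mem_Ioi]; positivity⟩
    refine ((Real.tendsto_log_nhdsGT_zero.comp hw).atBot_div_const h2).congr fun m => ?_
    exact (intCast_eq_log_diam (i m) (k m)).symm
  have hktop : Tendsto (fun m => (k m : ℝ)) atTop atTop := by
    refine ((Real.tendsto_log_atTop.comp htop).atTop_div_const h2).congr fun m => ?_
    exact (intCast_eq_log_diam (i m) (k m)).symm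
  have hfin := fun m => hσ.ne_top (i m) (k m)
  have hnegbot : ∀ᶠ m in atBot, (k m : ℝ) < 0 := hkbot.eventually_lt_atBot 0
  have hpostop : ∀ᶠ m in atTop, (0 : ℝ) < k m := hktop.eventually_gt_atTop 0
  obtain ⟨hne1, hr1⟩ := eventually_ratio_eq hup0
    (hnegbot.mono fun m hm => by exact_mod_cast hm.ne) hfin hrbot
  obtain ⟨hne2, hr2⟩ := eventually_ratio_eq hlo.ne'
    (hpostop.mono fun m hm => by exact_mod_cast hm.ne') hfin hrtop
  constructor
  · have hmain : q⁻¹.toReal * δlo⁻¹.toReal ≤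
        p⁻¹.toReal - (⨅ i, b i) * (p⁻¹.toReal + 1 / (2 * deltaS)) := by
      set e := p⁻¹.toReal - (⨅ i, b i) * (p⁻¹.toReal + 1 / (2 * deltaS)) with he
      have hlim : Tendsto (fun m => Real.log (C * 14580 * N) / (k m * Real.log 3) + e) atTop
          (𝓝 e) := by
        simpa using (tendsto_const_nhds.div_atTop (hktop.atTop_mul_const h3)).add_const e
      refine le_of_tendsto_of_tendsto (hr2.const_mul q⁻¹.toReal) hlim ?_
      filter_upwards [hne2, hpostop] with m hm hk
      -- Once divided by `k m * log 3`, the constant disappears in the limit.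
      have h1 := log_le_of_rpow_le hm (hfin m) hc (measure_rpow_le_of_forall_le h hp hq0 hb hm
        fun j => mul_le_mul_of_nonneg_left (ciInf_le (finite_range b).bddBelow j) hk.le)
      have hk3 : 0 < k m * Real.log 3 := mul_pos hk h3
      rw [← mul_div_assoc, div_add' _ _ _ hk3.ne', div_le_div_iff_of_pos_right hk3]
      linarith
    refine le_trans ?_ (le_max_left _ _)
    rw [toReal_mul_inv hq0 hlo.ne', le_div_iff₀ hsθ]
    linarith
  · have hmain : p⁻¹.toReal - (⨆ i, b i) * (p⁻¹.toReal + 1 / (2 * deltaS)) ≤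
        q⁻¹.toReal * δup⁻¹.toReal := by
      set e := p⁻¹.toReal - (⨆ i, b i) * (p⁻¹.toReal + 1 / (2 * deltaS)) with he
      have hlim : Tendsto (fun m => Real.log (C * 14580 * N) / (k m * Real.log 3) + e) atBot
          (𝓝 e) := by
        simpa using (tendsto_const_nhds.div_atBot (hkbot.atBot_mul_const h3)).add_const e
      refine le_of_tendsto_of_tendsto hlim (hr1.const_mul q⁻¹.toReal) ?_
      filter_upwards [hne1, hnegbot] with m hm hk
      -- Now `k m < 0`: the supremum takes the place of the infimum, and division reverses the
      -- inequality.
      have h1 := log_le_of_rpow_le hm (hfin m) hc (measure_rpow_le_of_forall_le h hp hq0 hb hm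
        fun j => mul_le_mul_of_nonpos_left (le_ciSup (finite_range b).bddAbove j) hk.le)
      have hk3 : k m * Real.log 3 < 0 := mul_neg_of_neg_of_pos hk h3
      rw [← mul_div_assoc, div_add' _ _ _ hk3.ne, div_le_div_right_of_neg hk3]
      linarith
    -- The positive part in the exponent requires the supremum to be nonnegative, which holds
    -- because some `b i ≥ 0` exists.
    refine max_le ?_ ((hb ⟨0, hN⟩).1.trans (le_ciSup (finite_range b).bddAbove _))
    rw [toReal_mul_inv hq0 hup0, div_le_iff₀ hsθ]
    linarith

lemma sobolevExponent_mono {p q δlo δup : ℝ≥0∞} (hq : q ≠ 0) (hlo : 0 < δlo) (hlu : δlo ≤ δup) :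
    sobolevExponent p q δlo ≤ sobolevExponent p q δup := by
  have hsθ : 0 < p⁻¹.toReal + 1 / (2 * deltaS) :=
    add_pos_of_nonneg_of_pos ENNReal.toReal_nonneg one_div_two_mul_deltaS_pos
  refine max_le_max (div_le_div_of_nonneg_right (sub_le_sub_left ?_ _) hsθ.le) le_rfl
  exact ENNReal.toReal_mono (ENNReal.inv_ne_top.2 (mul_ne_zero hq hlo.ne'))
    (ENNReal.inv_le_inv.2 (mul_le_mul_right hlu q))

end Gasket

end

theorem mainTheorem2 :
    (∀ K : ℝ≥0, 1 ≤ K → ∃ C : ℝ≥0, 0 < C ∧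
      ∀ (p q δlo δup : ℝ≥0∞) (σ : MeasureTheory.Measure Gasket.infGasket),
        1 ≤ p → p ≤ q → 2 ≤ q → 0 < δlo → δlo ≤ δup → 1 ≤ δup →
        Gasket.DyadicUpperRegular σ K δlo δup →
        Gasket.SobolevInequality σ p q C
          ![Gasket.sobolevExponent p q δup, Gasket.sobolevExponent p q δlo]) ∧
    (∀ (p q δlo δup : ℝ≥0∞) (σ : MeasureTheory.Measure Gasket.infGasket) (K : ℝ≥0),
        1 ≤ p → p ≤ q → 2 ≤ q → 0 < δlo → δlo ≤ δup → 1 ≤ δup → 1 ≤ K →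
        Gasket.DyadicUpperRegular σ K δlo δup →
        Gasket.ExponentsAttained σ δlo δup →
        ∀ (N : ℕ) (b : Fin N → ℝ) (C : ℝ≥0), 0 < N → (∀ i, b i ∈ Set.Icc (0 : ℝ) 1) → 0 < C →
          Gasket.SobolevInequality σ p q C b →
          (⨅ i, b i) ≤ Gasket.sobolevExponent p q δlo ∧
          Gasket.sobolevExponent p q δlo ≤ Gasket.sobolevExponent p q δup ∧
          Gasket.sobolevExponent p q δup ≤ ⨆ i, b i) := by
  refine ⟨fun K hK => ⟨1440 * K, by positivity, ?_⟩, ?_⟩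
  · intro p q δlo δup σ hp hpq hq hlo hlu hup hσ
    exact Gasket.sobolevInequality_of_dyadicUpperRegular hK hp hpq hq hlo hlu hup hσ
  · intro p q δlo δup σ K hp _ hq hlo hlu _ _ hσ hatt N b C hN hb hC h
    obtain ⟨h1, h2⟩ := h.exponents_optimal hp hq hlo hlu hσ hatt hN hb hC
    exact ⟨h1, Gasket.sobolevExponent_mono (two_pos.trans_le hq).ne' hlo hlu, h2⟩
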